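/- Let $A$ be a finite-dimensional real alternative algebra with unity $1\neq 0$, equipped with a real linear anti-involution $x\mapsto x^c$ (so $(x^c)^c=x$, $(xy)^c=y^cx^c$, and $r^c=r$ for $r\in\mathbb R$). Put $n(x)=xx^c$, $\mathbb S_A=\{J\in A: J+J^c=0,\ JJ^c=1\}$, assumed non-empty, and $Q_A=\bigcup_{J\in\mathbb S_A}\{\alpha+\beta J:\alpha,\beta\in\mathbb R\}$. Let $\|\cdot\|$ be a norm of the real vector space $A$ with $\|x\|=\sqrt{n(x)}$ for all $x\in Q_A$. Let $n\ge 1$. For $D\subseteq\mathbb C^n$ non-empty, open and invariant under conjugation of each coordinate, let $\Omega_D$ be the set of points $x=(\alpha_1+J_1\beta_1,\dots,\alpha_n+J_n\beta_n)$ with $J_h\in\mathbb S_A$ and $z=(\alpha_1+i\beta_1,\dots,\alpha_n+i\beta_n)\in D$. A stem function on $D$ is a function $F=\sum_{K\subseteq\{1,\dots,n\}}e_KF_K:D\to A\otimes\mathbb R^{2^n}$, where $(e_K)_K$ is a basis of $\mathbb R^{2^n}$, such that conjugation of $z_h$ changes the sign of $F_K$ if $h\in K$ and leaves $F_K$ unchanged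 if $h\notin K$. It induces $f=\mathcal I(F):\Omega_D\to A$, $f(x)=\sum_K[J_K,F_K(z)]$, where $[J_K,v]=J_{k_1}(J_{k_2}(\cdots(J_{k_p}v)\cdots))$ for $K=\{k_1<\dots<k_p\}$. Let $\mathcal J_h$ be the complex structure on $A\otimes\mathbb R^{2^n}$ with $\mathcal J_h(e_Ka)=e_{K\cup\{h\}}a$ if $h\notin K$ and $\mathcal J_h(e_Ka)=-e_{K\setminus\{h\}}a$ if $h\in K$. For $F$ of class $\mathscr C^1$ put $\partial_hF=\frac12(\partial_{\alpha_h}F-\mathcal J_h\,\partial_{\beta_h}F)$, $\overline\partial_hF=\frac12(\partial_{\alpha_h}F+\mathcal J_h\,\partial_{\beta_h}F)$ and $\frac{\partial f}{\partial x_h}=\mathcal I(\partial_hF)$. The function $f=\mathcal I(F)$ is slice regular if $F$ is a $\mathscr C^1$ stem function with $\overline\partial_hF=0$ on $D$ for all $h$. For $x\in A^n$, $\ell\in\mathbb N^n$, $a\in A$ put $x^\ell a=x_1^{\ell_1}(x_2^{\ell_2}(\cdots(x_n^{\ell_n}a)\cdots))$. A power series $\sum_{\ell\in\mathbb N^n}X^\ell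 a_\ell$ with $a_\ell\in A$ is convergent if there are real numbers $C$ and $M>0$ such that $\|a_\ell\|\le C\,M^{|\ell|}$ for all $\ell$, where $|\ell|=\ell_1+\dots+\ell_n$. A function $f$ is a sum of it on a set $\Omega$ if moreover, for every $x\in\Omega$, the series $\sum_\ell x^\ell a_\ell$ converges (unconditionally) to $f(x)$. **Theorem.** Let $\rho>0$ and $\mathbb B_\rho=\{x\in (Q_A)^n:\|x_h\|<\rho,\ h=1,\dots,n\}$. A function $f:\mathbb B_\rho\to A$ is slice regular if and only if $f$ is on $\mathbb B_\rho$ a sum of a convergent power series $\sum_{\ell\in\mathbb N^n}X^\ell a_\ell$ with coefficients in $A$. Moreover, if $f$ is slice regular, then for every such series $$a_\ell=(\ell!)^{-1}\,\partial_\ell f(0)\qquad\text{for all }\ell=(\ell_1,\dots,\ell_n)\in\mathbb N^n,$$ where $\ell!=\ell_1!\cdots\ell_n!$ and $\partial_\ell f$ is the iterated slice partial derivative (which exists) obtained by composing, in any order, $\ell_1$ times $\partial/\partial x_1$, ..., $\ell_n$ times $\partial/\partial x_n$. -/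

import Mathlib

open scoped BigOperators

namespace SliceReg

/-- A unital, not necessarily associative ring together with a norm of its additive group.
No compatibility of the norm with the multiplication is required. -/
class NonAssocRingWithNorm (A : Type*) extends NormedAddCommGroup A, NonAssocRing A

/-- A (not necessarily associative) ring is alternative: `x²y = x(xy)` and `(yx)x = yx²`. -/
class IsAlternative (A : Type*) [NonAssocRing A] : Prop where
  left_alt : ∀ x y : A, (x * x) * y = x * (x * y)
  right_alt : ∀ x y : A, (y * x) * x = y * (x * x)

section Algebra

variable (A : Type*) [NonAssocRing A] [Module ℝ A] [StarRing A]

/-- The sphere `𝕊_A` of imaginary units: trace `t(J) = J + J^c = 0`, squared norm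
`n(J) = J J^c = 1`. -/
def imagUnits : Set A := {J | J + star J = 0 ∧ J * star J = 1}

/-- The quadratic cone `Q_A`, the union of the complex slices `ℂ_J = ⟨1, J⟩`, `J ∈ 𝕊_A`. -/
def quadCone : Set A :=
  {x | ∃ J ∈ imagUnits A, ∃ α β : ℝ, x = α • (1 : A) + β • J}

end Algebra

section Points

variable {A : Type*} [NonAssocRing A] [Module ℝ A] {n : ℕ}

/-- The point `(α₁ + J₁ β₁, …, αₙ + Jₙ βₙ)` of `Aⁿ`, where `z = (α₁ + i β₁, …, αₙ + i βₙ)`. -/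
def slicePoint (J : Fin n → A) (z : Fin n → ℂ) : Fin n → A :=
  fun h => (z h).re • (1 : A) + (z h).im • J h

/-- The circularization `Ω_W` in `Aⁿ` of a subset `W` of `ℂⁿ`. -/
def circularization [StarRing A] (W : Set (Fin n → ℂ)) : Set (Fin n → A) :=
  {x | ∃ z ∈ W, ∃ J : Fin n → A, (∀ h, J h ∈ imagUnits A) ∧ x = slicePoint J z}

/-- The ordered product `[u_H, v] = u_{h₁}(u_{h₂}(⋯(u_{h_p} v)⋯))`, where
`H = {h₁ < ⋯ < h_p}`. -/
def orderedProd (u : Fin n → A) (H : Finset (Fin n)) (v : A) : A :=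
  (H.sort (· ≤ ·)).foldr (fun h w => u h * w) v

/-- The power `x ^ k` in a power-associative algebra (here bracketed from the right). -/
def npow (x : A) : ℕ → A
  | 0 => 1
  | k + 1 => x * npow x k

/-- The ordered monomial `x^ℓ a = [(x₁^{ℓ₁}, …, xₙ^{ℓₙ}), a]`. -/
def monomial (x : Fin n → A) (ℓ : Fin n → ℕ) (a : A) : A :=
  orderedProd (fun h => npow (x h) (ℓ h)) Finset.univ a

end Points

/-- The point obtained from `z` by conjugating its `h`-th coordinate. -/
def conjAt {n : ℕ} (h : Fin n) (z : Fin n → ℂ) : Fin n → ℂ :=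
  Function.update z h (starRingEnd ℂ (z h))

/-- `D ⊆ ℂⁿ` is invariant under all the complex conjugations. -/
def ConjInvariant {n : ℕ} (D : Set (Fin n → ℂ)) : Prop :=
  ∀ z ∈ D, ∀ h, conjAt h z ∈ D

/-- The real vector space `A ⊗ ℝ^{2ⁿ}`: the element `∑_K e_K a_K` is given by its family of
components `(a_K)`, `K ⊆ {1, …, n}`. -/
abbrev StemSpace (A : Type*) (n : ℕ) : Type _ := Finset (Fin n) → A

section Stem

variable {A : Type*} {n : ℕ}

/-- The complex structure `𝒥_h` of `A ⊗ ℝ^{2ⁿ}` such that `𝒥_h (e_K a) = e_{K ∪ {h}} a` if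
`h ∉ K` and `𝒥_h (e_K a) = - e_{K ∖ {h}} a` if `h ∈ K`, written in components. -/
def cplxStr [AddCommGroup A] (h : Fin n) (a : StemSpace A n) : StemSpace A n :=
  fun K => if h ∈ K then a (K.erase h) else - a (insert h K)

/-- `F` is a stem function on `D` (only the values of `F` on `D` matter). -/
def IsStem [AddCommGroup A] (D : Set (Fin n → ℂ)) (F : (Fin n → ℂ) → StemSpace A n) : Prop :=
  ∀ z ∈ D, ∀ (K : Finset (Fin n)) (h : Fin n),
    F (conjAt h z) K = if h ∈ K then - F z K else F z K

variable [NormedAddCommGroup A] [NormedSpace ℝ A]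

/-- `∂F/∂α_h` -/
noncomputable def partialRe (h : Fin n) (F : (Fin n → ℂ) → StemSpace A n) (z : Fin n → ℂ) :
    StemSpace A n :=
  fderiv ℝ F z (Pi.single h 1)

/-- `∂F/∂β_h` -/
noncomputable def partialIm (h : Fin n) (F : (Fin n → ℂ) → StemSpace A n) (z : Fin n → ℂ) :
    StemSpace A n :=
  fderiv ℝ F z (Pi.single h Complex.I)

/-- The Cauchy-Riemann operator `∂_h F = (∂F/∂α_h - 𝒥_h (∂F/∂β_h)) / 2`. -/
noncomputable def stemD (h : Fin n) (F : (Fin n → ℂ) → StemSpace A n) (z : Fin n → ℂ) :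
    StemSpace A n :=
  (1 / 2 : ℝ) • (partialRe h F z - cplxStr h (partialIm h F z))

/-- The Cauchy-Riemann operator `∂̄_h F = (∂F/∂α_h + 𝒥_h (∂F/∂β_h)) / 2`. -/
noncomputable def stemDbar (h : Fin n) (F : (Fin n → ℂ) → StemSpace A n) (z : Fin n → ℂ) :
    StemSpace A n :=
  (1 / 2 : ℝ) • (partialRe h F z + cplxStr h (partialIm h F z))

end Stem

section Slice

variable {A : Type*} [NonAssocRingWithNorm A] [NormedSpace ℝ A] [StarRing A] {n : ℕ}

/-- `f = ℐ(F)` on `Ω_D`: `f(x) = ∑_K [J_K, F_K(z)]` for all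
`x = (α₁ + J₁ β₁, …, αₙ + Jₙ βₙ) ∈ Ω_D`. -/
def IsInducedBy (D : Set (Fin n → ℂ)) (f : (Fin n → A) → A)
    (F : (Fin n → ℂ) → StemSpace A n) : Prop :=
  ∀ z ∈ D, ∀ J : Fin n → A, (∀ h, J h ∈ imagUnits A) →
    f (slicePoint J z) = ∑ K : Finset (Fin n), orderedProd J K (F z K)

/-- `Ω = Ω_D` with `D` nonempty, open and invariant under complex conjugations. -/
def IsCircularOf (Ω : Set (Fin n → A)) (D : Set (Fin n → ℂ)) : Prop :=
  D.Nonempty ∧ IsOpen D ∧ ConjInvariant D ∧ Ω = circularization D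

/-- `f` is slice regular on the circular set `Ω`: `Ω = Ω_D` and `f` is induced on `Ω_D` by a
`C¹` stem function on `D` that is holomorphic (only the values of `f` on `Ω` matter). -/
def SliceRegularOn (f : (Fin n → A) → A) (Ω : Set (Fin n → A)) : Prop :=
  ∃ D : Set (Fin n → ℂ), IsCircularOf Ω D ∧
    ∃ F : (Fin n → ℂ) → StemSpace A n, IsStem D F ∧ ContDiffOn ℝ 1 F D ∧
      (∀ h, ∀ z ∈ D, stemDbar h F z = 0) ∧ IsInducedBy D f F

/-- `g` is on `Ω` the slice partial derivative `∂f/∂x_h = ℐ(∂_h F)`, where `f = ℐ(F)` with `F`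
of class `C¹`. -/
def HasSlicePartial (Ω : Set (Fin n → A)) (h : Fin n) (f g : (Fin n → A) → A) : Prop :=
  ∃ D : Set (Fin n → ℂ), IsCircularOf Ω D ∧
    ∃ F : (Fin n → ℂ) → StemSpace A n, IsStem D F ∧ ContDiffOn ℝ 1 F D ∧
      IsInducedBy D f F ∧ IsInducedBy D g (stemD h F)

/-- `g` is on `Ω` the iterated slice partial derivative of `f` obtained by applying
`∂/∂x_{h₁}`, then `∂/∂x_{h₂}`, and so on, along the list `[h₁, h₂, …]`. -/
def HasIterSlicePartial (Ω : Set (Fin n → A)) :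
    List (Fin n) → ((Fin n → A) → A) → ((Fin n → A) → A) → Prop
  | [], f, g => Set.EqOn g f Ω
  | h :: w, f, g => ∃ f₁, HasSlicePartial Ω h f f₁ ∧ HasIterSlicePartial Ω w f₁ g

variable (A n) in
/-- The product of balls `𝔹_ρ` of radius `ρ` centred at `0`, within the set `(Q_A)ⁿ` on which
slice functions live. -/
def prodBall (ρ : ℝ) : Set (Fin n → A) := {x | ∀ h, x h ∈ quadCone A ∧ ‖x h‖ < ρ}

/-- The formal power series with coefficients `a` is convergent: its coefficients grow at most
geometrically in `|ℓ|`. -/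
def IsConvergentSeries (a : (Fin n → ℕ) → A) : Prop :=
  ∃ C M : ℝ, 0 < M ∧ ∀ ℓ : Fin n → ℕ, ‖a ℓ‖ ≤ C * M ^ (∑ h, ℓ h)

/-- `f` is on `Ω` the sum of the convergent ordered power series `∑_ℓ x^ℓ a_ℓ`. -/
def IsSumOn (f : (Fin n → A) → A) (a : (Fin n → ℕ) → A) (Ω : Set (Fin n → A)) : Prop :=
  IsConvergentSeries a ∧ ∀ x ∈ Ω, HasSum (fun ℓ : Fin n → ℕ => monomial x ℓ (a ℓ)) (f x)

end Slice

end SliceReg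

/-!
Fix an imaginary unit `J`. Left multiplication by `J` is a complex structure on the real vector
space `A`: alternativity gives `J (J v) = J² v = -v` (`exists_complex_coordinates`). On the slice
`ℂ_Jⁿ` the slice function induced by a stem function `F` is `∑_K J^{|K|} F_K`, and the map
`b ↦ ∑_K J^{|K|} b_K` turns each complex structure `𝒥_h` into multiplication by `J`
(`sliceMap_cplxStr`). So holomorphic stem functions become ordinary holomorphic functions of `n`
complex variables with values in `A ≅ ℂ^d` (`contDiffOn_complex_sliceMap`), which have a Taylor
expansion on the whole polydisc (`exists_hasSum_of_contDiffOn_ball`). As the scalars act through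
`J`, the Taylor coefficients are elements of `A`.

In the other direction, the monomial `x^ℓ a` is induced by the stem function whose component at `K`
is `a` times the product of `Im z_h^{ℓ_h}` for `h ∈ K` and `Re z_h^{ℓ_h}` for `h ∉ K`
(`monomial_slicePoint`). A power series converging at the real points of the product of balls
converges absolutely on smaller polydiscs, so these stem functions sum to a stem function
`seriesStem a`. Differentiated term by term, it is of class `C¹` and holomorphic, and its
Cauchy-Riemann derivative `∂_h` is the stem function of the formally differentiated series.

The two directions meet in a uniqueness statement (`IsStem.eq_of_const_slice`): the parity of a
stem function under conjugation of single coordinates recovers all its components from the sums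
`∑_K J^{|K|} F_K`, by orthogonality of the characters of `(ℤ/2)ⁿ`. Hence an identity on one slice
`ℂ_Jⁿ` extends to the whole product of balls, and every slice partial derivative of the sum of a
power series is the sum of the differentiated series. Evaluation at the origin then gives the
coefficients.
-/

namespace SliceReg

/-! ### Taylor expansion of holomorphic functions on a polydisc -/

section PowerSeries

open Metric MeasureTheory

/-- A product of summable nonnegative sequences, one for each coordinate, is summable over the
multi-indices. -/
theorem summable_prod_apply {n : ℕ} (u : Fin n → ℕ → ℝ) (h0 : ∀ h k, 0 ≤ u h k)
    (hu : ∀ h, Summable (u h)) : Summable fun ℓ : Fin n → ℕ => ∏ h, u h (ℓ h) := by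
  induction n with
  | zero => exact Summable.of_finite
  | succ n ih =>
    have h1 := (hu 0).mul_of_nonneg (ih (fun h => u h.succ) (fun h => h0 h.succ)
      fun h => hu h.succ) (fun k => h0 0 k) fun ℓ => Finset.prod_nonneg fun h _ => h0 _ _
    rw [← (Fin.consEquiv fun _ : Fin (n + 1) => ℕ).summable_iff]
    refine h1.congr fun p => ?_
    simp [Fin.prod_univ_succ, Fin.consEquiv]

/-- On an open set, having a continuous derivative means being of class `C¹`. -/
theorem contDiffOn_one_of_hasFDerivAt {𝕜 H E : Type*} [NontriviallyNormedField 𝕜]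
    [NormedAddCommGroup H] [NormedSpace 𝕜 H] [NormedAddCommGroup E] [NormedSpace 𝕜 E]
    {U : Set H} (hU : IsOpen U) {f : H → E} {f' : H → H →L[𝕜] E} (hf' : ContinuousOn f' U)
    (hd : ∀ z ∈ U, HasFDerivAt f (f' z) z) : ContDiffOn 𝕜 1 f U := by
  rw [show (1 : WithTop ℕ∞) = 0 + 1 from rfl, contDiffOn_succ_iff_fderiv_of_isOpen hU]
  refine ⟨fun z hz => (hd z hz).differentiableAt.differentiableWithinAt, by simp, ?_⟩
  exact contDiffOn_zero.2 (hf'.congr fun z hz => (hd z hz).fderiv)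

section Parametric

variable {H E : Type*} [NormedAddCommGroup H] [NormedAddCommGroup E]

/-- Near a point of the open set `U`, a function continuous on `ℝ × U` is bounded uniformly over
a compact interval of the first variable. -/
theorem exists_closedBall_bound [ProperSpace H] {G : ℝ → H → E} {U : Set H} (hU : IsOpen U)
    (hG : ContinuousOn (Function.uncurry G) (Set.univ ×ˢ U)) (a b : ℝ) {z : H} (hz : z ∈ U) :
    ∃ δ > 0, closedBall z δ ⊆ U ∧
      ∃ C, ∀ t ∈ Set.uIcc a b, ∀ w ∈ closedBall z δ, ‖G t w‖ ≤ C := by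
  obtain ⟨δ, hδ, hsub⟩ := nhds_basis_closedBall.mem_iff.1 (hU.mem_nhds hz)
  obtain ⟨C, hC⟩ := (isCompact_uIcc.prod (isCompact_closedBall z δ)).exists_bound_of_continuousOn
    (hG.mono (Set.prod_mono (Set.subset_univ (Set.uIcc a b)) hsub))
  exact ⟨δ, hδ, hsub, C, fun t ht w hw => hC (t, w) ⟨ht, hw⟩⟩

theorem continuous_slice {G : ℝ → H → E} {U : Set H}
    (hG : ContinuousOn (Function.uncurry G) (Set.univ ×ˢ U)) {z : H} (hz : z ∈ U) :
    Continuous fun t => G t z := by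
  rw [← continuousOn_univ]
  exact hG.comp (f := fun t : ℝ => (t, z)) (by fun_prop) fun t _ => ⟨trivial, hz⟩

variable [ProperSpace H]

theorem continuousOn_parametric_intervalIntegral [NormedSpace ℝ E] {G : ℝ → H → E} {U : Set H}
    (hU : IsOpen U) (hG : ContinuousOn (Function.uncurry G) (Set.univ ×ˢ U)) (a b : ℝ) :
    ContinuousOn (fun z => ∫ t in a..b, G t z) U := by
  intro z hz
  obtain ⟨δ, hδ, hsub, C, hC⟩ := exists_closedBall_bound hU hG a b hz
  have hnhds : closedBall z δ ∈ nhds z := closedBall_mem_nhds z hδ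
  refine (intervalIntegral.continuousAt_of_dominated_interval (bound := fun _ => C) ?_ ?_
    (by simp) ?_).continuousWithinAt
  · filter_upwards [hnhds] with w hw
    exact (continuous_slice hG (hsub hw)).aestronglyMeasurable
  · filter_upwards [hnhds] with w hw
    exact Filter.Eventually.of_forall fun t ht => hC t (Set.uIoc_subset_uIcc ht) w hw
  · refine Filter.Eventually.of_forall fun t _ => ?_
    have h1 : ContinuousAt (Function.uncurry G) (t, z) :=
      hG.continuousAt ((isOpen_univ.prod hU).mem_nhds ⟨trivial, hz⟩)
    exact h1.comp (f := fun w => (t, w)) (by fun_prop)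

variable [NormedSpace ℂ H] [NormedSpace ℂ E]

theorem hasFDerivAt_parametric_intervalIntegral {G : ℝ → H → E} {G' : ℝ → H → H →L[ℂ] E}
    {U : Set H} (hU : IsOpen U) (hG : ContinuousOn (Function.uncurry G) (Set.univ ×ˢ U))
    (hG' : ContinuousOn (Function.uncurry G') (Set.univ ×ˢ U))
    (hd : ∀ t, ∀ z ∈ U, HasFDerivAt (G t) (G' t z) z) (a b : ℝ) {z : H} (hz : z ∈ U) :
    HasFDerivAt (fun z => ∫ t in a..b, G t z) (∫ t in a..b, G' t z) z := by
  obtain ⟨δ, hδ, hsub, C, hC⟩ := exists_closedBall_bound hU hG' a b hz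
  have hnhds : closedBall z δ ∈ nhds z := closedBall_mem_nhds z hδ
  refine intervalIntegral.hasFDerivAt_integral_of_dominated_of_fderiv_le (𝕜 := ℂ)
    (F := fun z t => G t z) (F' := fun z t => G' t z) (bound := fun _ => C)
    hnhds ?_ ?_ ?_ ?_ (intervalIntegrable_const (μ := volume)) ?_
  · filter_upwards [hnhds] with w hw
    exact (continuous_slice hG (hsub hw)).aestronglyMeasurable
  · exact (continuous_slice hG hz).intervalIntegrable _ _
  · exact (continuous_slice hG' hz).aestronglyMeasurable
  · exact Filter.Eventually.of_forall fun t ht w hw => hC t (Set.uIoc_subset_uIcc ht) w hw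
  · exact Filter.Eventually.of_forall fun t ht w hw => hd t w (hsub hw)

/-- Differentiation under the integral sign for `C¹` functions of a parameter. -/
theorem contDiffOn_one_parametric_intervalIntegral {G : ℝ → H → E} {G' : ℝ → H → H →L[ℂ] E}
    {U : Set H} (hU : IsOpen U) (hG : ContinuousOn (Function.uncurry G) (Set.univ ×ˢ U))
    (hG' : ContinuousOn (Function.uncurry G') (Set.univ ×ˢ U))
    (hd : ∀ t, ∀ z ∈ U, HasFDerivAt (G t) (G' t z) z) (a b : ℝ) :
    ContDiffOn ℂ 1 (fun z => ∫ t in a..b, G t z) U := by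
  have key := fun z hz => hasFDerivAt_parametric_intervalIntegral hU hG hG' hd a b (z := z) hz
  exact contDiffOn_one_of_hasFDerivAt hU
    (continuousOn_parametric_intervalIntegral hU hG' a b) key

end Parametric

variable {E : Type*} [NormedAddCommGroup E] [NormedSpace ℂ E] {n : ℕ} {ρ : ℝ}

theorem cons_mem_ball (hρ : 0 < ρ) {t : ℂ} {z : Fin n → ℂ} :
    (Fin.cons t z : Fin (n + 1) → ℂ) ∈ ball (0 : Fin (n + 1) → ℂ) ρ ↔
      t ∈ ball (0 : ℂ) ρ ∧ z ∈ ball (0 : Fin n → ℂ) ρ := by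
  simp [pi_norm_lt_iff hρ, Fin.forall_fin_succ]

theorem cons_mem_closedBall (hρ : 0 ≤ ρ) {t : ℂ} {z : Fin n → ℂ} :
    (Fin.cons t z : Fin (n + 1) → ℂ) ∈ closedBall (0 : Fin (n + 1) → ℂ) ρ ↔
      t ∈ closedBall (0 : ℂ) ρ ∧ z ∈ closedBall (0 : Fin n → ℂ) ρ := by
  simp [pi_norm_le_iff_of_nonneg hρ, Fin.forall_fin_succ]

theorem differentiableOn_cons_left (hρ : 0 < ρ) {f : (Fin (n + 1) → ℂ) → E}
    (hf : ContDiffOn ℂ 1 f (ball 0 ρ)) {z : Fin n → ℂ} (hz : z ∈ ball (0 : Fin n → ℂ) ρ) :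
    DifferentiableOn ℂ (fun t : ℂ => f (Fin.cons t z)) (ball 0 ρ) := by
  refine (hf.differentiableOn one_ne_zero).comp
    (f := fun t : ℂ => (Fin.cons t z : Fin (n + 1) → ℂ)) ?_
    fun t ht => (cons_mem_ball hρ).2 ⟨ht, hz⟩
  exact (differentiable_pi.2 (Fin.cases (by simp) (by simp))).differentiableOn

/-- The Taylor coefficients at `0` with respect to the first variable of a holomorphic function
on a polydisc are holomorphic functions of the other variables. -/
theorem contDiffOn_iteratedDeriv_cons [CompleteSpace E] (hρ : 0 < ρ) {f : (Fin (n + 1) → ℂ) → E}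
    (hf : ContDiffOn ℂ 1 f (ball 0 ρ)) (k : ℕ) :
    ContDiffOn ℂ 1 (fun z : Fin n → ℂ =>
      (k.factorial : ℂ)⁻¹ • iteratedDeriv k (fun t : ℂ => f (Fin.cons t z)) 0) (ball 0 ρ) := by
  -- The coefficient is a Cauchy integral over a circle whose radius `r < ρ` does not matter.
  set r := ρ / 2
  have hr : 0 < r := half_pos hρ
  have hrρ : r < ρ := half_lt_self hρ
  have hmem : ∀ (t : ℝ), ∀ z ∈ ball (0 : Fin n → ℂ) ρ,
      (Fin.cons (circleMap 0 r t) z : Fin (n + 1) → ℂ) ∈ ball (0 : Fin (n + 1) → ℂ) ρ :=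
    fun t z hz => (cons_mem_ball hρ).2 ⟨by simpa [abs_of_pos hr] using hrρ, hz⟩
  let c : ℝ → ℂ := fun t => deriv (circleMap 0 r) t * (1 / (circleMap 0 r t - 0) ^ (k + 1))
  have hc : Continuous c := by
    refine Continuous.mul ?_ ?_
    · rw [show deriv (circleMap 0 r) = fun t => circleMap 0 r t * Complex.I from
        funext (deriv_circleMap 0 r)]
      fun_prop
    refine continuous_const.div (by fun_prop) fun t => pow_ne_zero _ ?_
    exact sub_ne_zero.2 (circleMap_ne_center hr.ne')
  let L := Fin.consEquivL ℂ fun _ : Fin (n + 1) => ℂ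
  let ι : (Fin n → ℂ) →L[ℂ] (Fin (n + 1) → ℂ) :=
    (L : (ℂ × (Fin n → ℂ)) →L[ℂ] _) ∘L ContinuousLinearMap.inr ℂ ℂ (Fin n → ℂ)
  have hcons : ContinuousOn (fun p : ℝ × (Fin n → ℂ) =>
      (Fin.cons (circleMap 0 r p.1) p.2 : Fin (n + 1) → ℂ)) (Set.univ ×ˢ ball 0 ρ) := by
    have : Continuous fun p : ℝ × (Fin n → ℂ) => L (circleMap 0 r p.1, p.2) := by fun_prop
    exact this.continuousOn
  have hint := contDiffOn_one_parametric_intervalIntegral (H := Fin n → ℂ) (U := ball 0 ρ)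
    (G := fun t z => c t • f (Fin.cons (circleMap 0 r t) z))
    (G' := fun t z => c t • (fderiv ℂ f (Fin.cons (circleMap 0 r t) z) ∘L ι)) isOpen_ball
    ((hc.comp continuous_fst).continuousOn.smul
      (hf.continuousOn.comp hcons fun p hp => hmem _ _ hp.2))
    ((hc.comp continuous_fst).continuousOn.smul
      (ContinuousOn.clm_comp ((hf.continuousOn_fderiv_of_isOpen isOpen_ball le_rfl).comp hcons
        fun p hp => hmem _ _ hp.2) continuousOn_const)) ?_ 0 (2 * Real.pi)
  · refine (hint.const_smul (2 * Real.pi * Complex.I)⁻¹).congr fun z hz => ?_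
    have h1 := ((differentiableOn_cons_left hρ hf hz).mono
      (closedBall_subset_ball hrρ)).circleIntegral_one_div_sub_center_pow_smul hr k
    have h2 : (∫ t in (0 : ℝ)..2 * Real.pi, c t • f (Fin.cons (circleMap 0 r t) z)) =
        (2 * Real.pi * Complex.I / k.factorial) •
          iteratedDeriv k (fun t : ℂ => f (Fin.cons t z)) 0 := by
      rw [← h1, circleIntegral]
      simp only [c, mul_smul]
    simp only [h2, smul_smul]
    congr 1
    field_simp [Complex.two_pi_I_ne_zero]
  · intro t z hz
    have h1 : HasFDerivAt f (fderiv ℂ f (Fin.cons (circleMap 0 r t) z))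
        (Fin.cons (circleMap 0 r t) z) :=
      ((hf.differentiableOn one_ne_zero).differentiableAt
        (isOpen_ball.mem_nhds (hmem t z hz))).hasFDerivAt
    have h2 : HasFDerivAt (fun z : Fin n → ℂ => L (circleMap 0 r t, z)) ι z :=
      L.hasFDerivAt.comp z (hasFDerivAt_prodMk_right _ _)
    exact (h1.comp z h2).const_smul (c t)

/-- A holomorphic function on a polydisc centred at `0` is there the sum of a power series, and
the coefficients satisfy the Cauchy estimates. -/
theorem exists_hasSum_of_contDiffOn_ball [CompleteSpace E] (hρ : 0 < ρ) {f : (Fin n → ℂ) → E}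
    (hf : ContDiffOn ℂ 1 f (ball 0 ρ)) :
    ∃ c : (Fin n → ℕ) → E,
      (∀ r M : ℝ, 0 < r → r < ρ → (∀ z ∈ closedBall (0 : Fin n → ℂ) r, ‖f z‖ ≤ M) →
        ∀ ℓ, ‖c ℓ‖ ≤ M / r ^ ∑ h, ℓ h) ∧
      ∀ z ∈ ball (0 : Fin n → ℂ) ρ, HasSum (fun ℓ => (∏ h, z h ^ ℓ h) • c ℓ) (f z) := by
  induction n with
  | zero =>
    refine ⟨fun _ => f 0, fun r M hr _ hM ℓ => ?_, fun z _ => ?_⟩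
    · simpa using hM 0 (by simp [hr.le])
    · rw [Subsingleton.elim z 0]
      simp
  | succ n ih =>
    -- The Taylor coefficients in the first variable are expanded in the remaining ones.
    choose c hcb hcs using fun k => ih (contDiffOn_iteratedDeriv_cons hρ hf k)
    have hb : ∀ r M : ℝ, 0 < r → r < ρ → (∀ z ∈ closedBall (0 : Fin (n + 1) → ℂ) r, ‖f z‖ ≤ M) →
        ∀ k ℓ, ‖c k ℓ‖ ≤ M / r ^ k / r ^ ∑ h, ℓ h := by
      intro r M hr hrρ hM k ℓ
      refine hcb k r _ hr hrρ (fun z hz => ?_) ℓ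
      have h1 := Complex.norm_iteratedDeriv_le_of_forall_mem_sphere_norm_le k hr
        (((differentiableOn_cons_left hρ hf (closedBall_subset_ball hrρ hz)).mono
          ((closure_ball_subset_closedBall).trans (closedBall_subset_ball hrρ))).diffContOnCl)
        fun t ht => hM _ ((cons_mem_closedBall hr.le).2 ⟨sphere_subset_closedBall ht, hz⟩)
      rw [norm_smul, norm_inv, Complex.norm_natCast]
      calc _ ≤ (k.factorial : ℝ)⁻¹ * (k.factorial * M / r ^ k) := by gcongr
        _ = M / r ^ k := by field_simp
    refine ⟨fun ℓ => c (ℓ 0) (Fin.tail ℓ), fun r M hr hrρ hM ℓ => ?_, fun z hz => ?_⟩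
    · refine (hb r M hr hrρ hM _ _).trans_eq ?_
      rw [Fin.sum_univ_succ, pow_add, div_div]
      rfl
    · obtain ⟨r, hzr, hrρ⟩ := exists_between (mem_ball_zero_iff.1 hz)
      have hr : 0 < r := (norm_nonneg z).trans_lt hzr
      obtain ⟨M, hM⟩ := (isCompact_closedBall (0 : Fin (n + 1) → ℂ) r).exists_bound_of_continuousOn
        (hf.continuousOn.mono (closedBall_subset_ball hrρ))
      have hz' : z = Fin.cons (z 0) (Fin.tail z) := (Fin.cons_self_tail z).symm
      have hmem : z 0 ∈ ball (0 : ℂ) ρ ∧ Fin.tail z ∈ ball (0 : Fin n → ℂ) ρ :=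
        (cons_mem_ball hρ).1 (hz' ▸ hz)
      have hsum : Summable fun ℓ : Fin (n + 1) → ℕ =>
          (∏ h, z h ^ ℓ h) • c (ℓ 0) (Fin.tail ℓ) := by
        have hq : ∀ h, Summable fun k : ℕ => (‖z h‖ / r) ^ k := fun h =>
          summable_geometric_of_lt_one (by positivity)
            ((div_lt_one hr).2 ((norm_le_pi_norm z h).trans_lt hzr))
        refine Summable.of_norm_bounded
          ((summable_prod_apply _ (fun h k => by positivity) hq).mul_left M) fun ℓ => ?_
        have h1 := hb r M hr hrρ hM (ℓ 0) (Fin.tail ℓ)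
        rw [div_div, ← pow_add] at h1
        have h2 : ℓ 0 + ∑ h, Fin.tail ℓ h = ∑ h, ℓ h := (Fin.sum_univ_succ ℓ).symm
        rw [h2] at h1
        rw [norm_smul, norm_prod]
        calc _ ≤ (∏ h, ‖z h ^ ℓ h‖) * (M / r ^ ∑ h, ℓ h) := by gcongr
          _ = _ := by
            simp only [norm_pow, div_pow, Finset.prod_div_distrib, Finset.prod_pow_eq_pow_sum]
            ring
      let e := Fin.consEquiv fun _ : Fin (n + 1) => ℕ
      have hfib : ∀ k, HasSum (fun ℓ : Fin n → ℕ =>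
          (∏ h, z h ^ (e (k, ℓ)) h) • c ((e (k, ℓ)) 0) (Fin.tail (e (k, ℓ))))
          (z 0 ^ k • (k.factorial : ℂ)⁻¹ •
            iteratedDeriv k (fun t : ℂ => f (Fin.cons t (Fin.tail z))) 0) := by
        intro k
        refine ((hcs k _ hmem.2).const_smul (z 0 ^ k)).congr_fun fun ℓ => ?_
        simp [e, Fin.consEquiv, Fin.prod_univ_succ, mul_smul, Fin.tail]
      have h1 := ((e.summable_iff.2 hsum).hasSum).prod_fiberwise hfib
      have h2 := Complex.hasSum_taylorSeries_on_ball
        (differentiableOn_cons_left hρ hf hmem.2) hmem.1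
      have h3 := h1.unique (h2.congr_fun fun k => by rw [sub_zero, smul_comm])
      have h4 := (e.summable_iff.2 hsum).hasSum
      rw [h3, ← hz'] at h4
      exact e.hasSum_iff.1 h4

end PowerSeries

/-! ### Ordered products and monomials -/

section Algebra

variable {A : Type*} [NonAssocRing A] {n : ℕ}

@[simp]
theorem orderedProd_empty (u : Fin n → A) (v : A) : orderedProd u ∅ v = v := by
  simp [orderedProd]

theorem orderedProd_insert (u : Fin n → A) {h : Fin n} {s : Finset (Fin n)}
    (hs : ∀ j ∈ s, h < j) (v : A) :
    orderedProd u (insert h s) v = u h * orderedProd u s v := by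
  rw [orderedProd, Finset.sort_insert _ (fun j hj => (hs j hj).le)
    (fun hh => lt_irrefl _ (hs h hh))]
  rfl

theorem orderedProd_add (u : Fin n → A) (K : Finset (Fin n)) (v w : A) :
    orderedProd u K (v + w) = orderedProd u K v + orderedProd u K w := by
  induction K using Finset.induction_on_min with
  | empty => simp
  | insert h s hs ih => simp only [orderedProd_insert u hs, ih, mul_add]

variable [Module ℝ A]

theorem orderedProd_smul [SMulCommClass ℝ A A] (u : Fin n → A) (K : Finset (Fin n)) (r : ℝ)
    (v : A) : orderedProd u K (r • v) = r • orderedProd u K v := by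
  induction K using Finset.induction_on_min with
  | empty => simp
  | insert h s hs ih => simp only [orderedProd_insert u hs, ih, mul_smul_comm]

/-- The ordered product `v ↦ [u_K, v]` as a real linear map. -/
def orderedProdLin [SMulCommClass ℝ A A] (u : Fin n → A) (K : Finset (Fin n)) : A →ₗ[ℝ] A where
  toFun := orderedProd u K
  map_add' := orderedProd_add u K
  map_smul' := orderedProd_smul u K

@[simp]
theorem orderedProdLin_apply [SMulCommClass ℝ A A] (u : Fin n → A) (K : Finset (Fin n)) (v : A) :
    orderedProdLin u K v = orderedProd u K v := rfl

/-- Expansion of an ordered product of binomials `p_h + q_h J_h`. -/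
theorem orderedProd_binomial [SMulCommClass ℝ A A] [IsScalarTower ℝ A A] (J : Fin n → A)
    (p q : Fin n → ℝ) (s : Finset (Fin n)) (a : A) :
    orderedProd (fun h => p h • (1 : A) + q h • J h) s a =
      ∑ K ∈ s.powerset, (∏ h ∈ s, if h ∈ K then q h else p h) • orderedProd J K a := by
  induction s using Finset.induction_on_min with
  | empty => simp
  | insert h s hs ih =>
    have hh : h ∉ s := fun hh => lt_irrefl _ (hs h hh)
    rw [orderedProd_insert _ hs, ih, Finset.sum_powerset_insert hh, ← Finset.sum_add_distrib,
      Finset.mul_sum]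
    refine Finset.sum_congr rfl fun K hK => ?_
    have hKs := Finset.mem_powerset.1 hK
    have h1 : (∏ j ∈ s, if j ∈ insert h K then q j else p j) =
        ∏ j ∈ s, if j ∈ K then q j else p j :=
      Finset.prod_congr rfl fun j hj => by simp [(hs j hj).ne']
    rw [Finset.prod_insert hh, Finset.prod_insert hh, h1, if_neg fun hk => hh (hKs hk),
      if_pos (Finset.mem_insert_self h K), orderedProd_insert J fun j hj => hs j (hKs hj)]
    simp only [add_mul, smul_mul_assoc, one_mul, mul_smul_comm]
    module

/-- The component at `K` of the stem function of the monomial `x^ℓ`: the product of the imaginary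
parts of `z_h^{ℓ_h}` for `h ∈ K` and of their real parts for `h ∉ K`. -/
def stemMonomial (ℓ : Fin n → ℕ) (z : Fin n → ℂ) (K : Finset (Fin n)) : ℝ :=
  ∏ h, if h ∈ K then (z h ^ ℓ h).im else (z h ^ ℓ h).re

section Star

variable [StarRing A]

omit [Module ℝ A] in
theorem star_eq_neg_of_mem_imagUnits {J : A} (hJ : J ∈ imagUnits A) : star J = -J :=
  eq_neg_of_add_eq_zero_right hJ.1

omit [Module ℝ A] in
theorem mul_self_of_mem_imagUnits {J : A} (hJ : J ∈ imagUnits A) : J * J = -1 := by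
  have h := hJ.2
  rw [star_eq_neg_of_mem_imagUnits hJ, mul_neg] at h
  rw [← h, neg_neg]

omit [Module ℝ A] in
theorem mul_mul_of_mem_imagUnits [IsAlternative A] {J : A} (hJ : J ∈ imagUnits A) (v : A) :
    J * (J * v) = -v := by
  rw [← IsAlternative.left_alt, mul_self_of_mem_imagUnits hJ, neg_mul, one_mul]

variable [SMulCommClass ℝ A A] [IsScalarTower ℝ A A]

theorem npow_slice {J : A} (hJ : J ∈ imagUnits A) (w : ℂ) (k : ℕ) :
    npow (w.re • (1 : A) + w.im • J) k = (w ^ k).re • (1 : A) + (w ^ k).im • J := by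
  induction k with
  | zero => simp [npow]
  | succ k ih =>
    rw [npow, ih, pow_succ', Complex.mul_re, Complex.mul_im]
    simp only [add_mul, mul_add, smul_mul_assoc, one_mul, mul_one, mul_smul_comm,
      mul_self_of_mem_imagUnits hJ]
    module

/-- The ordered monomial `x^ℓ a` is the slice function induced by its stem function. -/
theorem monomial_slicePoint {J : Fin n → A} (hJ : ∀ h, J h ∈ imagUnits A) (z : Fin n → ℂ)
    (ℓ : Fin n → ℕ) (a : A) :
    monomial (slicePoint J z) ℓ a =
      ∑ K : Finset (Fin n), orderedProd J K (stemMonomial ℓ z K • a) := by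
  have h1 : (fun h => npow (slicePoint J z h) (ℓ h)) =
      fun h => (z h ^ ℓ h).re • (1 : A) + (z h ^ ℓ h).im • J h :=
    funext fun h => npow_slice (hJ h) (z h) (ℓ h)
  rw [monomial, h1, orderedProd_binomial, Finset.powerset_univ]
  exact Finset.sum_congr rfl fun K _ => (orderedProd_smul J K _ a).symm

end Star

/-! ### The complex structure given by an imaginary unit -/

section ComplexStructure

variable [StarRing A] [SMulCommClass ℝ A A] [IsAlternative A]

/-- Left multiplication by an imaginary unit `J` is a complex structure on `A`, because
`J (J v) = J² v = -v`; hence `A` is identified with some `ℂ^d`. -/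
theorem exists_complex_coordinates [Module.Finite ℝ A] {J : A} (hJ : J ∈ imagUnits A) :
    ∃ (d : ℕ) (e : A ≃ₗ[ℝ] (Fin d → ℂ)), ∀ v, e (J * v) = Complex.I • e v := by
  let φ : ℂ →ₐ[ℝ] Module.End ℝ A := Complex.lift
    ⟨LinearMap.mulLeft ℝ J, LinearMap.ext fun v => by
      simp [mul_mul_of_mem_imagUnits hJ]⟩
  let _ : Module ℂ A := Module.compHom A φ.toRingHom
  have hI : ∀ v : A, Complex.I • v = J * v := fun v => by
    change φ Complex.I v = J * v
    simp [φ]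
  have _ : IsScalarTower ℝ ℂ A := ⟨fun r w v => by
    change φ (r • w) v = r • φ w v
    simp⟩
  have _ : Module.Finite ℂ A := Module.Finite.of_restrictScalars_finite ℝ ℂ A
  let b := (Module.finBasis ℂ A).equivFun
  refine ⟨_, b.restrictScalars ℝ, fun v => ?_⟩
  rw [← hI]
  exact b.map_smul _ _

omit [StarRing A] [SMulCommClass ℝ A A] [IsAlternative A] in
theorem map_orderedProd_const {d : ℕ} {J : A} {e : A ≃ₗ[ℝ] (Fin d → ℂ)}
    (he : ∀ v, e (J * v) = Complex.I • e v) (K : Finset (Fin n)) (v : A) :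
    e (orderedProd (fun _ => J) K v) = Complex.I ^ K.card • e v := by
  induction K using Finset.induction_on_min with
  | empty => simp
  | insert h s hs ih =>
    rw [orderedProd_insert _ hs, he, ih, smul_smul,
      Finset.card_insert_of_notMem fun hh => lt_irrefl _ (hs h hh), pow_succ']

omit [IsAlternative A] in
theorem map_monomial_const [IsScalarTower ℝ A A] {d : ℕ} {J : A} (hJ : J ∈ imagUnits A)
    {e : A ≃ₗ[ℝ] (Fin d → ℂ)}
    (he : ∀ v, e (J * v) = Complex.I • e v) (z : Fin n → ℂ) (ℓ : Fin n → ℕ) (a : A) :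
    e (monomial (slicePoint (fun _ => J) z) ℓ a) = (∏ h, z h ^ ℓ h) • e a := by
  rw [monomial]
  induction (Finset.univ : Finset (Fin n)) using Finset.induction_on_min with
  | empty => simp
  | insert h s hs ih =>
    rw [orderedProd_insert _ hs, Finset.prod_insert fun hh => lt_irrefl _ (hs h hh), mul_smul,
      ← ih, slicePoint, npow_slice hJ, add_mul, smul_mul_assoc, one_mul, smul_mul_assoc, map_add,
      map_smul, map_smul, he]
    conv_rhs => rw [← Complex.re_add_im (z h ^ ℓ h)]
    rw [add_smul, mul_smul, Complex.coe_smul, Complex.coe_smul]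

end ComplexStructure

end Algebra

/-! ### Uniqueness of the stem function -/

section Uniqueness

variable {A : Type*} {n : ℕ}

/-- The conjugation of the coordinates of `z` with index in `S`. -/
def conjOn (S : Finset (Fin n)) (z : Fin n → ℂ) : Fin n → ℂ :=
  fun h => if h ∈ S then starRingEnd ℂ (z h) else z h

theorem conjOn_empty (z : Fin n → ℂ) : conjOn ∅ z = z := by
  ext h; simp [conjOn]

theorem conjOn_insert {S : Finset (Fin n)} {h : Fin n} (hh : h ∉ S) (z : Fin n → ℂ) :
    conjOn (insert h S) z = conjAt h (conjOn S z) := by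
  funext j
  rcases eq_or_ne j h with rfl | hj
  · simp [conjOn, conjAt, hh]
  · simp [conjOn, conjAt, hj]

theorem ConjInvariant.conjOn_mem {D : Set (Fin n → ℂ)} (hD : ConjInvariant D) {z : Fin n → ℂ}
    (hz : z ∈ D) (S : Finset (Fin n)) : conjOn S z ∈ D := by
  induction S using Finset.induction_on with
  | empty => rwa [conjOn_empty]
  | insert h S hh ih => rw [conjOn_insert hh]; exact hD _ ih h

variable [AddCommGroup A] [Module ℝ A]

theorem IsStem.apply_conjOn {D : Set (Fin n → ℂ)} (hD : ConjInvariant D)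
    {F : (Fin n → ℂ) → StemSpace A n} (hF : IsStem D F) {z : Fin n → ℂ} (hz : z ∈ D)
    (S K : Finset (Fin n)) :
    F (conjOn S z) K = (∏ h ∈ S, if h ∈ K then (-1 : ℝ) else 1) • F z K := by
  induction S using Finset.induction_on with
  | empty => simp [conjOn_empty]
  | insert h S hh ih =>
    rw [conjOn_insert hh, hF _ (hD.conjOn_mem hz S), ih, Finset.prod_insert hh]
    split_ifs <;> simp

/-- Inversion of the characters `S ↦ (-1)^{|S ∩ K|}` of `(ℤ/2)ⁿ`. -/
theorem eq_zero_of_sum_characters_eq_zero (c : Finset (Fin n) → A)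
    (hc : ∀ S : Finset (Fin n),
      ∑ K : Finset (Fin n), (∏ h ∈ S, if h ∈ K then (-1 : ℝ) else 1) • c K = 0)
    (K₀ : Finset (Fin n)) : c K₀ = 0 := by
  have horth : ∀ K : Finset (Fin n), ∑ S : Finset (Fin n),
      (∏ h ∈ S, if h ∈ K₀ then (-1 : ℝ) else 1) * (∏ h ∈ S, if h ∈ K then (-1 : ℝ) else 1) =
      if K = K₀ then 2 ^ n else 0 := by
    intro K
    simp only [← Finset.prod_mul_distrib]
    rw [← Finset.powerset_univ, ← Finset.prod_one_add]
    split_ifs with hK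
    · subst hK
      have h2 : ∀ h, (1 : ℝ) + (if h ∈ K then (-1 : ℝ) else 1) * (if h ∈ K then (-1 : ℝ) else 1)
          = 2 := fun h => by split_ifs <;> norm_num
      simp only [h2, Finset.prod_const, Finset.card_univ, Fintype.card_fin]
    · obtain ⟨h, hh⟩ : ∃ h, ¬(h ∈ K ↔ h ∈ K₀) := by
        by_contra! hall
        exact hK (Finset.ext hall)
      refine Finset.prod_eq_zero (Finset.mem_univ h) ?_
      by_cases h1 : h ∈ K <;> by_cases h2 : h ∈ K₀ <;> simp_all
  have h0 : ∑ S : Finset (Fin n), (∏ h ∈ S, if h ∈ K₀ then (-1 : ℝ) else 1) •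
      ∑ K : Finset (Fin n), (∏ h ∈ S, if h ∈ K then (-1 : ℝ) else 1) • c K = 0 :=
    Finset.sum_eq_zero fun S _ => by rw [hc, smul_zero]
  simp only [Finset.smul_sum, smul_smul] at h0
  rw [Finset.sum_comm] at h0
  simp only [← Finset.sum_smul, horth, ite_smul, zero_smul, Finset.sum_ite_eq',
    Finset.mem_univ, if_true] at h0
  exact (smul_eq_zero.1 h0).resolve_left (by positivity)

end Uniqueness

section StemUniqueness

variable {A : Type*} [NonAssocRing A] [Module ℝ A] [StarRing A] [SMulCommClass ℝ A A]
  [IsAlternative A] {n : ℕ}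

omit [Module ℝ A] [SMulCommClass ℝ A A] in
theorem eq_zero_of_orderedProd_const_eq_zero {J : A} (hJ : J ∈ imagUnits A)
    (K : Finset (Fin n)) {v : A} (hv : orderedProd (fun _ => J) K v = 0) : v = 0 := by
  induction K using Finset.induction_on_min with
  | empty => simpa using hv
  | insert h s hs ih =>
    rw [orderedProd_insert _ hs] at hv
    refine ih ?_
    rw [← neg_eq_zero, ← mul_mul_of_mem_imagUnits hJ, hv, mul_zero]

/-- A stem function is determined by the values of the induced slice function on the slice
`ℂ_Jⁿ` of one imaginary unit: conjugating the coordinates separates the components. -/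
theorem IsStem.eq_of_const_slice {D : Set (Fin n → ℂ)} (hD : ConjInvariant D)
    {F F' : (Fin n → ℂ) → StemSpace A n} (hF : IsStem D F) (hF' : IsStem D F') {J : A}
    (hJ : J ∈ imagUnits A)
    (h : ∀ z ∈ D, ∑ K : Finset (Fin n), orderedProd (fun _ => J) K (F z K) =
      ∑ K : Finset (Fin n), orderedProd (fun _ => J) K (F' z K)) :
    Set.EqOn F F' D := by
  intro z hz
  funext K
  refine sub_eq_zero.1 (eq_zero_of_orderedProd_const_eq_zero hJ K ?_)
  refine eq_zero_of_sum_characters_eq_zero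
    (fun K => orderedProd (fun _ => J) K (F z K - F' z K)) (fun S => ?_) K
  have h1 := h _ (hD.conjOn_mem hz S)
  simp only [hF.apply_conjOn hD hz, hF'.apply_conjOn hD hz, orderedProd_smul] at h1
  simp only [← orderedProdLin_apply, map_sub, smul_sub, Finset.sum_sub_distrib] at h1 ⊢
  exact sub_eq_zero.2 h1

end StemUniqueness

/-! ### The product of balls as a circular set -/

section Ball

open Metric

variable {A : Type*} [NonAssocRingWithNorm A] [NormedSpace ℝ A] [StarRing A] {n : ℕ}
  [SMulCommClass ℝ A A] [IsScalarTower ℝ A A] [StarModule ℝ A]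

theorem slice_mul_star {J : A} (hJ : J ∈ imagUnits A) (w : ℂ) :
    (w.re • (1 : A) + w.im • J) * star (w.re • (1 : A) + w.im • J) = (‖w‖ ^ 2) • (1 : A) := by
  rw [Complex.sq_norm, Complex.normSq_apply]
  simp only [star_add, star_smul, star_one, star_eq_neg_of_mem_imagUnits hJ, star_trivial,
    add_mul, mul_add, smul_mul_assoc, one_mul, mul_one, mul_smul_comm, mul_neg, smul_neg,
    mul_self_of_mem_imagUnits hJ]
  module

variable [Nontrivial A]

omit [StarRing A] [SMulCommClass ℝ A A] [IsScalarTower ℝ A A] [StarModule ℝ A] in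
theorem smul_one_injective : Function.Injective fun r : ℝ => r • (1 : A) :=
  smul_left_injective ℝ one_ne_zero

/-- The norm of `A` restricts to the modulus on every complex slice. -/
theorem norm_slice (hnorm : ∀ x ∈ quadCone A, x * star x = (‖x‖ ^ 2) • (1 : A)) {J : A}
    (hJ : J ∈ imagUnits A) (w : ℂ) : ‖w.re • (1 : A) + w.im • J‖ = ‖w‖ := by
  have h1 := hnorm _ ⟨J, hJ, w.re, w.im, rfl⟩
  rw [slice_mul_star hJ] at h1
  exact ((sq_eq_sq₀ (norm_nonneg _) (norm_nonneg _)).1 (smul_one_injective h1)).symm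

theorem eq_or_eq_conj_of_slice_eq {J J' : A} (hJ : J ∈ imagUnits A) (hJ' : J' ∈ imagUnits A)
    {w w' : ℂ} (h : w.re • (1 : A) + w.im • J = w'.re • (1 : A) + w'.im • J') :
    w = w' ∨ w = starRingEnd ℂ w' := by
  have htr : ∀ {J : A}, J ∈ imagUnits A → ∀ w : ℂ,
      (w.re • (1 : A) + w.im • J) + star (w.re • (1 : A) + w.im • J) = (2 * w.re) • (1 : A) := by
    intro J hJ w
    simp only [star_add, star_smul, star_one, star_eq_neg_of_mem_imagUnits hJ, star_trivial,
      smul_neg, two_mul, add_smul]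
    abel
  have hre : 2 * w.re = 2 * w'.re :=
    smul_one_injective (A := A) (by simp only [← htr hJ w, ← htr hJ' w', h])
  have hn : ‖w‖ ^ 2 = ‖w'‖ ^ 2 :=
    smul_one_injective (A := A) (by simp only [← slice_mul_star hJ w, ← slice_mul_star hJ' w', h])
  rw [Complex.sq_norm, Complex.sq_norm, Complex.normSq_apply, Complex.normSq_apply] at hn
  have hre' : w.re = w'.re := by linarith
  rw [hre'] at hn
  rcases mul_self_eq_mul_self_iff.1 (add_left_cancel hn) with him | him
  · exact Or.inl (Complex.ext hre' him)
  · exact Or.inr (Complex.ext hre' him)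

theorem slicePoint_mem_prodBall
    (hnorm : ∀ x ∈ quadCone A, x * star x = (‖x‖ ^ 2) • (1 : A)) {ρ : ℝ} (hρ : 0 < ρ)
    {J : Fin n → A} (hJ : ∀ h, J h ∈ imagUnits A) {z : Fin n → ℂ} :
    slicePoint J z ∈ prodBall A n ρ ↔ z ∈ ball (0 : Fin n → ℂ) ρ := by
  rw [mem_ball_zero_iff, pi_norm_lt_iff hρ]
  refine forall_congr' fun h => ?_
  rw [slicePoint, norm_slice hnorm (hJ h)]
  exact and_iff_right ⟨J h, hJ h, _, _, rfl⟩

theorem conjInvariant_ball {ρ : ℝ} (hρ : 0 < ρ) :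
    ConjInvariant (ball (0 : Fin n → ℂ) ρ) := by
  intro z hz h
  rw [mem_ball_zero_iff, pi_norm_lt_iff hρ] at hz ⊢
  intro j
  rcases eq_or_ne j h with rfl | hj
  · simpa [conjAt] using hz j
  · simpa [conjAt, hj] using hz j

theorem isCircularOf_prodBall
    (hnorm : ∀ x ∈ quadCone A, x * star x = (‖x‖ ^ 2) • (1 : A)) {ρ : ℝ} (hρ : 0 < ρ) :
    IsCircularOf (prodBall A n ρ) (ball (0 : Fin n → ℂ) ρ) := by
  refine ⟨nonempty_ball.2 hρ, isOpen_ball, conjInvariant_ball hρ, Set.ext fun x => ⟨?_, ?_⟩⟩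
  · intro hx
    choose J hJ α β hx' using fun h => (hx h).1
    have hxe : x = slicePoint J fun h => ⟨α h, β h⟩ := funext hx'
    exact ⟨_, (slicePoint_mem_prodBall hnorm hρ hJ).1 (hxe ▸ hx), J, hJ, hxe⟩
  · rintro ⟨z, hz, J, hJ, rfl⟩
    exact (slicePoint_mem_prodBall hnorm hρ hJ).2 hz

/-- The polydisc is the only conjugation invariant set whose circularization is the product of
balls, since a point of a complex slice determines its coordinates up to conjugation. -/
theorem IsCircularOf.eq_ball (hS : (imagUnits A).Nonempty)
    (hnorm : ∀ x ∈ quadCone A, x * star x = (‖x‖ ^ 2) • (1 : A)) {ρ : ℝ} (hρ : 0 < ρ)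
    {D : Set (Fin n → ℂ)} (hD : IsCircularOf (prodBall A n ρ) D) :
    D = ball (0 : Fin n → ℂ) ρ := by
  obtain ⟨J, hJ⟩ := hS
  obtain ⟨-, -, hinv, heq⟩ := hD
  ext z
  rw [← slicePoint_mem_prodBall hnorm hρ fun _ => hJ, heq]
  refine ⟨fun hz => ⟨z, hz, fun _ => J, fun _ => hJ, rfl⟩, ?_⟩
  rintro ⟨z', hz', J', hJ', h⟩
  have h1 := fun j => eq_or_eq_conj_of_slice_eq hJ (hJ' j) (congrFun h j)
  have h2 : z = conjOn (Finset.univ.filter fun j => z j ≠ z' j) z' := by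
    funext j
    by_cases hj : z j = z' j
    · simp [conjOn, hj]
    · simpa [conjOn, hj] using (h1 j).resolve_left hj
  rw [h2]
  exact hinv.conjOn_mem hz' _

end Ball

/-! ### Stem functions of power series -/

section SeriesStem

open Metric

section Monomials

variable {n : ℕ}

theorem continuous_cplxStr {A : Type*} [NormedAddCommGroup A] (h : Fin n) :
    Continuous (cplxStr h : StemSpace A n → StemSpace A n) := by
  refine continuous_pi fun K => ?_
  unfold cplxStr
  split_ifs <;> fun_prop

theorem cplxStr_cplxStr {A : Type*} [AddCommGroup A]
    (h : Fin n) (b : StemSpace A n) : cplxStr h (cplxStr h b) = -b := by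
  funext K
  by_cases hK : h ∈ K <;> simp [cplxStr, hK]

theorem stemMonomial_eq_mul (ℓ : Fin n → ℕ) (z : Fin n → ℂ) (K : Finset (Fin n)) (h : Fin n) :
    stemMonomial ℓ z K = (if h ∈ K then (z h ^ ℓ h).im else (z h ^ ℓ h).re) *
      ∏ j ∈ Finset.univ.erase h, if j ∈ K then (z j ^ ℓ j).im else (z j ^ ℓ j).re :=
  (Finset.mul_prod_erase Finset.univ
    (fun j => if j ∈ K then (z j ^ ℓ j).im else (z j ^ ℓ j).re) (Finset.mem_univ h)).symm

theorem stemMonomial_conjAt (ℓ : Fin n → ℕ) (z : Fin n → ℂ) (K : Finset (Fin n)) (h : Fin n) :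
    stemMonomial ℓ (conjAt h z) K = if h ∈ K then -stemMonomial ℓ z K else stemMonomial ℓ z K := by
  have h1 : ∀ j ∈ Finset.univ.erase h,
      (if j ∈ K then (conjAt h z j ^ ℓ j).im else (conjAt h z j ^ ℓ j).re) =
        if j ∈ K then (z j ^ ℓ j).im else (z j ^ ℓ j).re := fun j hj => by
    simp [conjAt, Finset.ne_of_mem_erase hj]
  rw [stemMonomial_eq_mul _ _ _ h, stemMonomial_eq_mul _ z _ h, Finset.prod_congr rfl h1]
  have h2 : conjAt h z h ^ ℓ h = starRingEnd ℂ (z h ^ ℓ h) := by simp [conjAt]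
  rw [h2, Complex.conj_im, Complex.conj_re]
  split_ifs <;> simp

theorem abs_stemMonomial_le {r : ℝ} {z : Fin n → ℂ} (hz : ‖z‖ ≤ r) (ℓ : Fin n → ℕ)
    (K : Finset (Fin n)) : |stemMonomial ℓ z K| ≤ r ^ ∑ h, ℓ h := by
  rw [stemMonomial, Finset.abs_prod, ← Finset.prod_pow_eq_pow_sum]
  refine Finset.prod_le_prod (fun _ _ => abs_nonneg _) fun h _ => ?_
  have h1 : ‖z h ^ ℓ h‖ ≤ r ^ ℓ h := by
    rw [norm_pow]
    exact pow_le_pow_left₀ (norm_nonneg _) ((norm_le_pi_norm z h).trans hz) _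
  split_ifs
  · exact (Complex.abs_im_le_norm _).trans h1
  · exact (Complex.abs_re_le_norm _).trans h1

theorem abs_cplxStr_stemMonomial_le {r : ℝ} {z : Fin n → ℂ} (hz : ‖z‖ ≤ r) (ℓ : Fin n → ℕ)
    (h : Fin n) (K : Finset (Fin n)) : |cplxStr h (stemMonomial ℓ z) K| ≤ r ^ ∑ h, ℓ h := by
  unfold cplxStr
  split_ifs
  · exact abs_stemMonomial_le hz _ _
  · rw [abs_neg]
    exact abs_stemMonomial_le hz _ _

/-- The real part of the `h`-th coordinate. -/
noncomputable def reCoord (h : Fin n) : (Fin n → ℂ) →L[ℝ] ℝ :=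
  Complex.reCLM ∘L ContinuousLinearMap.proj h

/-- The imaginary part of the `h`-th coordinate. -/
noncomputable def imCoord (h : Fin n) : (Fin n → ℂ) →L[ℝ] ℝ :=
  Complex.imCLM ∘L ContinuousLinearMap.proj h

@[simp]
theorem reCoord_apply (h : Fin n) (v : Fin n → ℂ) : reCoord h v = (v h).re := rfl

@[simp]
theorem imCoord_apply (h : Fin n) (v : Fin n → ℂ) : imCoord h v = (v h).im := rfl

theorem norm_reCoord_le (h : Fin n) : ‖reCoord h‖ ≤ 1 :=
  ContinuousLinearMap.opNorm_le_bound _ zero_le_one fun v => by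
    rw [one_mul]
    exact (Complex.abs_re_le_norm _).trans (norm_le_pi_norm v h)

theorem norm_imCoord_le (h : Fin n) : ‖imCoord h‖ ≤ 1 :=
  ContinuousLinearMap.opNorm_le_bound _ zero_le_one fun v => by
    rw [one_mul]
    exact (Complex.abs_im_le_norm _).trans (norm_le_pi_norm v h)

/-- The differential of the component at `K` of the stem function of `x^ℓ`. When `ℓ_h = 0` the
truncated subtraction `ℓ - e_h` is harmless, since the `h`-th term carries the factor `ℓ_h`. -/
noncomputable def stemMonomialDeriv (ℓ : Fin n → ℕ) (z : Fin n → ℂ) (K : Finset (Fin n)) :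
    (Fin n → ℂ) →L[ℝ] ℝ :=
  ∑ h, (ℓ h : ℝ) • (stemMonomial (ℓ - Pi.single h 1) z K • reCoord h +
    cplxStr h (stemMonomial (ℓ - Pi.single h 1) z) K • imCoord h)

theorem hasFDerivAt_stemMonomial (ℓ : Fin n → ℕ) (z : Fin n → ℂ) (K : Finset (Fin n)) :
    HasFDerivAt (fun z => stemMonomial ℓ z K) (stemMonomialDeriv ℓ z K) z := by
  have hpow : ∀ h, HasFDerivAt (fun z : Fin n → ℂ => z h ^ ℓ h)
      (((ContinuousLinearMap.toSpanSingleton ℂ ((ℓ h : ℂ) * z h ^ (ℓ h - 1))).restrictScalars ℝ) ∘L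
        ContinuousLinearMap.proj (R := ℝ) h) z := fun h =>
    HasFDerivAt.comp (g := fun w : ℂ => w ^ ℓ h) z
      ((hasDerivAt_pow (ℓ h) (z h)).hasFDerivAt.restrictScalars ℝ)
      (ContinuousLinearMap.proj (R := ℝ) (φ := fun _ : Fin n => ℂ) h).hasFDerivAt
  have hpart : ∀ h ∈ Finset.univ, HasFDerivAt
      (fun z : Fin n → ℂ => if h ∈ K then (z h ^ ℓ h).im else (z h ^ ℓ h).re)
      ((if h ∈ K then Complex.imCLM else Complex.reCLM) ∘L
        (((ContinuousLinearMap.toSpanSingleton ℂ ((ℓ h : ℂ) * z h ^ (ℓ h - 1))).restrictScalars ℝ)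
          ∘L ContinuousLinearMap.proj (R := ℝ) h)) z := by
    intro h _
    split_ifs
    · exact Complex.imCLM.hasFDerivAt.comp z (hpow h)
    · exact Complex.reCLM.hasFDerivAt.comp z (hpow h)
  refine (HasFDerivAt.finsetProd hpart).congr_fderiv (Finset.sum_congr rfl fun h _ => ?_)
  ext v
  have herase : ∀ K' : Finset (Fin n), (∀ j, j ≠ h → (j ∈ K' ↔ j ∈ K)) →
      (∏ j ∈ Finset.univ.erase h, if j ∈ K' then (z j ^ (ℓ - Pi.single h 1 : Fin n → ℕ) j).im
        else (z j ^ (ℓ - Pi.single h 1 : Fin n → ℕ) j).re) =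
      ∏ j ∈ Finset.univ.erase h, if j ∈ K then (z j ^ ℓ j).im else (z j ^ ℓ j).re := by
    refine fun K' hK' => Finset.prod_congr rfl fun j hj => ?_
    have hj' := Finset.ne_of_mem_erase hj
    simp [hK' j hj', hj']
  unfold cplxStr
  rw [stemMonomial_eq_mul _ _ K h, stemMonomial_eq_mul _ _ (K.erase h) h,
    stemMonomial_eq_mul _ _ (insert h K) h, herase K fun _ _ => Iff.rfl,
    herase (K.erase h) fun j hj => by simp [hj], herase (insert h K) fun j hj => by simp [hj]]
  by_cases hK : h ∈ K <;> simp [hK] <;> ring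

end Monomials

section Coefficients

variable {A : Type*} [NormedAddCommGroup A] [NormedSpace ℝ A] {n : ℕ}

/-- The power series with coefficients `a` converges absolutely on the polydisc of radius `ρ`. -/
def AbsConvergesOn (ρ : ℝ) (a : (Fin n → ℕ) → A) : Prop :=
  ∀ r, 0 < r → r < ρ → Summable fun ℓ => r ^ (∑ h, ℓ h) * ‖a ℓ‖

/-- The coefficients of the formal derivative of a power series with respect to the `h`-th
variable. -/
def formalDeriv (h : Fin n) (a : (Fin n → ℕ) → A) : (Fin n → ℕ) → A :=
  fun ℓ => ((ℓ h : ℝ) + 1) • a (ℓ + Pi.single h 1)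

/-- The stem function with components `∑_ℓ stemMonomial ℓ z K a_ℓ`, which induces the sum of the
power series with coefficients `a`. -/
noncomputable def seriesStem (a : (Fin n → ℕ) → A) (z : Fin n → ℂ) : StemSpace A n :=
  fun K => ∑' ℓ, stemMonomial ℓ z K • a ℓ

theorem isStem_seriesStem (D : Set (Fin n → ℂ)) (a : (Fin n → ℕ) → A) :
    IsStem D (seriesStem a) := by
  intro z _ K h
  simp only [seriesStem, stemMonomial_conjAt]
  split_ifs
  · simp only [neg_smul, tsum_neg]
  · rfl

theorem sum_add_single (ℓ : Fin n → ℕ) (h : Fin n) :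
    ∑ j, (ℓ + Pi.single h 1 : Fin n → ℕ) j = ∑ j, ℓ j + 1 := by
  simp [Finset.sum_add_distrib]

theorem add_single_injective (h : Fin n) :
    Function.Injective fun ℓ : Fin n → ℕ => ℓ + Pi.single h 1 :=
  add_left_injective _

theorem apply_eq_zero_of_notMem_range {h : Fin n} {ℓ : Fin n → ℕ}
    (hℓ : ℓ ∉ Set.range fun ℓ : Fin n → ℕ => ℓ + Pi.single h 1) : ℓ h = 0 := by
  by_contra h0
  refine hℓ ⟨ℓ - Pi.single h 1, funext fun j => ?_⟩
  rcases eq_or_ne j h with rfl | hj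
  · simp; omega
  · simp [hj]

theorem AbsConvergesOn.formalDeriv {ρ : ℝ} {a : (Fin n → ℕ) → A} (ha : AbsConvergesOn ρ a)
    (h : Fin n) : AbsConvergesOn ρ (formalDeriv h a) := by
  intro r hr hrρ
  obtain ⟨s, hrs, hsρ⟩ := exists_between hrρ
  have hs := hr.trans hrs
  have hq : r / s < 1 := (div_lt_one hs).2 hrs
  -- The factor `ℓ_h + 1` is absorbed by passing from the radius `r` to a larger radius `s`.
  have hlim : Filter.Tendsto (fun k : ℕ => ((k : ℝ) + 1) * (r / s) ^ k) Filter.atTop (nhds 0) := by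
    have h1 := (tendsto_self_mul_const_pow_of_lt_one (by positivity) hq).add
      (tendsto_pow_atTop_nhds_zero_of_lt_one (by positivity) hq)
    simpa [add_mul] using h1
  obtain ⟨C, hC⟩ := hlim.bddAbove_range
  have hC' : ∀ k : ℕ, ((k : ℝ) + 1) * (r / s) ^ k ≤ C := fun k => hC ⟨k, rfl⟩
  refine Summable.of_nonneg_of_le (fun ℓ => by positivity) (fun ℓ => ?_)
    ((((ha s hs hsρ).comp_injective (add_single_injective h))).mul_left (C / s))
  have hle : ((ℓ h : ℝ) + 1) ≤ ((∑ j, ℓ j : ℕ) : ℝ) + 1 := by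
    have := Finset.single_le_sum (f := ℓ) (fun _ _ => Nat.zero_le _) (Finset.mem_univ h)
    gcongr
  have hk := hC' (∑ j, ℓ j)
  rw [div_pow, ← mul_div_assoc, div_le_iff₀ (by positivity)] at hk
  have hnorm : ‖SliceReg.formalDeriv h a ℓ‖ = ((ℓ h : ℝ) + 1) * ‖a (ℓ + Pi.single h 1)‖ := by
    rw [SliceReg.formalDeriv, norm_smul, Real.norm_of_nonneg (by positivity)]
  rw [hnorm, Function.comp_apply, sum_add_single, pow_succ]
  calc r ^ (∑ j, ℓ j) * (((ℓ h : ℝ) + 1) * ‖a (ℓ + Pi.single h 1)‖)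
      = (((ℓ h : ℝ) + 1) * r ^ (∑ j, ℓ j)) * ‖a (ℓ + Pi.single h 1)‖ := by ring
    _ ≤ ((((∑ j, ℓ j : ℕ) : ℝ) + 1) * r ^ (∑ j, ℓ j)) * ‖a (ℓ + Pi.single h 1)‖ := by gcongr
    _ ≤ (C * s ^ (∑ j, ℓ j)) * ‖a (ℓ + Pi.single h 1)‖ := by gcongr
    _ = C / s * (s ^ (∑ j, ℓ j) * s * ‖a (ℓ + Pi.single h 1)‖) := by field_simp

variable [CompleteSpace A] {ρ : ℝ} {a : (Fin n → ℕ) → A}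

theorem AbsConvergesOn.hasSum_seriesStem (ha : AbsConvergesOn ρ a) {z : Fin n → ℂ}
    (hz : z ∈ ball (0 : Fin n → ℂ) ρ) (K : Finset (Fin n)) :
    HasSum (fun ℓ => stemMonomial ℓ z K • a ℓ) (seriesStem a z K) := by
  obtain ⟨r, hzr, hrρ⟩ := exists_between (mem_ball_zero_iff.1 hz)
  refine (Summable.of_norm_bounded (ha r ((norm_nonneg z).trans_lt hzr) hrρ) fun ℓ => ?_).hasSum
  rw [norm_smul, Real.norm_eq_abs]
  exact mul_le_mul_of_nonneg_right (abs_stemMonomial_le hzr.le ℓ K) (norm_nonneg _)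

/-- Reindexing of the terms obtained by differentiating a power series term by term. -/
theorem AbsConvergesOn.hasSum_formalDeriv (ha : AbsConvergesOn ρ a) {z : Fin n → ℂ}
    (hz : z ∈ ball (0 : Fin n → ℂ) ρ) (h : Fin n) (K : Finset (Fin n)) :
    HasSum (fun ℓ => ((ℓ h : ℝ) * stemMonomial (ℓ - Pi.single h 1) z K) • a ℓ)
      (seriesStem (SliceReg.formalDeriv h a) z K) := by
  refine ((add_single_injective h).hasSum_iff fun ℓ hℓ => ?_).1 ?_
  · simp [apply_eq_zero_of_notMem_range hℓ]
  · convert (ha.formalDeriv h).hasSum_seriesStem hz K using 2 with ℓ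
    simp [SliceReg.formalDeriv, smul_smul, mul_comm]

theorem AbsConvergesOn.hasSum_cplxStr_formalDeriv (ha : AbsConvergesOn ρ a) {z : Fin n → ℂ}
    (hz : z ∈ ball (0 : Fin n → ℂ) ρ) (h : Fin n) (K : Finset (Fin n)) :
    HasSum (fun ℓ => ((ℓ h : ℝ) * cplxStr h (stemMonomial (ℓ - Pi.single h 1) z) K) • a ℓ)
      (cplxStr h (seriesStem (SliceReg.formalDeriv h a) z) K) := by
  unfold cplxStr
  split_ifs
  · exact ha.hasSum_formalDeriv hz h _
  · simpa only [mul_neg, neg_smul] using (ha.hasSum_formalDeriv hz h (insert h K)).neg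

/-- The differential of the stem function of a power series: the partial derivatives are given by
the formal derivatives of the series. -/
noncomputable def seriesStemDeriv (a : (Fin n → ℕ) → A) (z : Fin n → ℂ) :
    (Fin n → ℂ) →L[ℝ] StemSpace A n :=
  ∑ h, ((reCoord h).smulRight (seriesStem (formalDeriv h a) z) +
    (imCoord h).smulRight (cplxStr h (seriesStem (formalDeriv h a) z)))

theorem norm_stemMonomialDeriv_le {r : ℝ} {z : Fin n → ℂ} (hz : ‖z‖ ≤ r) (ℓ : Fin n → ℕ)
    (K : Finset (Fin n)) :
    ‖stemMonomialDeriv ℓ z K‖ ≤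
      ∑ h, (ℓ h : ℝ) * (2 * r ^ ∑ j, (ℓ - Pi.single h 1 : Fin n → ℕ) j) := by
  refine norm_sum_le_of_le _ fun h _ => ?_
  rw [norm_smul, Real.norm_natCast]
  gcongr
  rw [two_mul]
  refine norm_add_le_of_le ?_ ?_
  · rw [norm_smul, Real.norm_eq_abs]
    exact (mul_le_of_le_one_right (abs_nonneg _) (norm_reCoord_le h)).trans
      (abs_stemMonomial_le hz _ _)
  · rw [norm_smul, Real.norm_eq_abs]
    exact (mul_le_of_le_one_right (abs_nonneg _) (norm_imCoord_le h)).trans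
      (abs_cplxStr_stemMonomial_le hz _ _ _)

/-- Term by term differentiation: the series of the differentials is dominated by the formally
differentiated series on a smaller polydisc. -/
theorem AbsConvergesOn.hasFDerivAt_seriesStem (ha : AbsConvergesOn ρ a) {z : Fin n → ℂ}
    (hz : z ∈ ball (0 : Fin n → ℂ) ρ) :
    HasFDerivAt (seriesStem a) (seriesStemDeriv a z) z := by
  refine hasFDerivAt_pi'' fun K => ?_
  obtain ⟨r, hzr, hrρ⟩ := exists_between (mem_ball_zero_iff.1 hz)
  have hr := (norm_nonneg z).trans_lt hzr
  have hbound : Summable fun ℓ : Fin n → ℕ =>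
      (∑ h, (ℓ h : ℝ) * (2 * r ^ ∑ j, (ℓ - Pi.single h 1 : Fin n → ℕ) j)) * ‖a ℓ‖ := by
    simp only [Finset.sum_mul]
    refine summable_sum fun h _ => ?_
    refine ((add_single_injective h).summable_iff fun ℓ hℓ => ?_).1 ?_
    · simp [apply_eq_zero_of_notMem_range hℓ]
    · refine ((ha.formalDeriv h r hr hrρ).mul_left 2).congr fun ℓ => ?_
      rw [SliceReg.formalDeriv, norm_smul, Real.norm_of_nonneg (by positivity),
        Function.comp_apply, add_tsub_cancel_right]
      simp only [Pi.add_apply, Pi.single_eq_same]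
      push_cast
      ring
  have hderiv := hasFDerivAt_tsum_of_isPreconnected (x₀ := (0 : Fin n → ℂ)) (x := z)
    (f := fun ℓ z => stemMonomial ℓ z K • a ℓ)
    (f' := fun ℓ z => (stemMonomialDeriv ℓ z K).smulRight (a ℓ)) hbound isOpen_ball
    (convex_ball (0 : Fin n → ℂ) r).isPreconnected
    (fun ℓ w _ => (hasFDerivAt_stemMonomial ℓ w K).smul_const (a ℓ)) (fun ℓ w hw => by
      rw [ContinuousLinearMap.norm_smulRight_apply]
      gcongr
      exact norm_stemMonomialDeriv_le (mem_ball_zero_iff.1 hw).le ℓ K)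
    (mem_ball_self hr) (ha.hasSum_seriesStem (mem_ball_self (hr.trans hrρ)) K).summable
    (mem_ball_zero_iff.2 hzr)
  refine hderiv.congr_fderiv ?_
  have hsum : HasSum (fun ℓ => (stemMonomialDeriv ℓ z K).smulRight (a ℓ))
      (∑ h, ((reCoord h).smulRight (seriesStem (SliceReg.formalDeriv h a) z K) +
        (imCoord h).smulRight (cplxStr h (seriesStem (SliceReg.formalDeriv h a) z) K))) := by
    have hsmul : ∀ (c : (Fin n → ℂ) →L[ℝ] ℝ) {g : (Fin n → ℕ) → A} {s : A}, HasSum g s →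
        HasSum (fun ℓ => c.smulRight (g ℓ)) (c.smulRight s) := fun c _ _ hg =>
      (ContinuousLinearMap.smulRightL ℝ (Fin n → ℂ) A c).hasSum hg
    refine (hasSum_sum fun h _ => (hsmul (reCoord h) (ha.hasSum_formalDeriv hz h K)).add
      (hsmul (imCoord h) (ha.hasSum_cplxStr_formalDeriv hz h K))).congr_fun fun ℓ => ?_
    ext v
    simp only [stemMonomialDeriv, ContinuousLinearMap.smulRight_apply,
      _root_.sum_apply, Finset.sum_smul, _root_.add_apply,
      _root_.smul_apply, smul_eq_mul]
    refine Finset.sum_congr rfl fun h _ => ?_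
    module
  rw [hsum.tsum_eq]
  ext v
  simp [seriesStemDeriv]

theorem AbsConvergesOn.contDiffOn_seriesStem (ha : AbsConvergesOn ρ a) :
    ContDiffOn ℝ 1 (seriesStem a) (ball (0 : Fin n → ℂ) ρ) := by
  refine contDiffOn_one_of_hasFDerivAt isOpen_ball ?_ fun z hz => ha.hasFDerivAt_seriesStem hz
  refine continuousOn_finsetSum _ fun h _ => ?_
  have h1 : ContinuousOn (seriesStem (SliceReg.formalDeriv h a)) (ball (0 : Fin n → ℂ) ρ) :=
    fun z hz => ((ha.formalDeriv h).hasFDerivAt_seriesStem hz).continuousAt.continuousWithinAt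
  exact ((ContinuousLinearMap.smulRightL ℝ (Fin n → ℂ) (StemSpace A n)
    (reCoord h)).continuous.comp_continuousOn h1).add
    ((ContinuousLinearMap.smulRightL ℝ (Fin n → ℂ) (StemSpace A n)
    (imCoord h)).continuous.comp_continuousOn ((continuous_cplxStr h).comp_continuousOn h1))

theorem AbsConvergesOn.partialRe_seriesStem (ha : AbsConvergesOn ρ a) {z : Fin n → ℂ}
    (hz : z ∈ ball (0 : Fin n → ℂ) ρ) (h : Fin n) :
    partialRe h (seriesStem a) z = seriesStem (SliceReg.formalDeriv h a) z := by
  rw [partialRe, (ha.hasFDerivAt_seriesStem hz).fderiv, seriesStemDeriv,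
    _root_.sum_apply, Finset.sum_eq_single h]
  · simp
  · intro j _ hj
    simp [hj]
  · simp

theorem AbsConvergesOn.partialIm_seriesStem (ha : AbsConvergesOn ρ a) {z : Fin n → ℂ}
    (hz : z ∈ ball (0 : Fin n → ℂ) ρ) (h : Fin n) :
    partialIm h (seriesStem a) z = cplxStr h (seriesStem (SliceReg.formalDeriv h a) z) := by
  rw [partialIm, (ha.hasFDerivAt_seriesStem hz).fderiv, seriesStemDeriv,
    _root_.sum_apply, Finset.sum_eq_single h]
  · simp
  · intro j _ hj
    simp [hj]
  · simp

theorem AbsConvergesOn.stemDbar_seriesStem (ha : AbsConvergesOn ρ a) {z : Fin n → ℂ}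
    (hz : z ∈ ball (0 : Fin n → ℂ) ρ) (h : Fin n) : stemDbar h (seriesStem a) z = 0 := by
  rw [stemDbar, ha.partialRe_seriesStem hz, ha.partialIm_seriesStem hz, cplxStr_cplxStr,
    add_neg_cancel, smul_zero]

theorem AbsConvergesOn.stemD_seriesStem (ha : AbsConvergesOn ρ a) {z : Fin n → ℂ}
    (hz : z ∈ ball (0 : Fin n → ℂ) ρ) (h : Fin n) :
    stemD h (seriesStem a) z = seriesStem (SliceReg.formalDeriv h a) z := by
  rw [stemD, ha.partialRe_seriesStem hz, ha.partialIm_seriesStem hz, cplxStr_cplxStr]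
  module

end Coefficients

end SeriesStem

/-! ### Holomorphic stem functions on a complex slice -/

section Holomorphic

open Metric

variable {A : Type*} [NormedAddCommGroup A] [NormedSpace ℝ A] {n d : ℕ}

/-- The real linear map `∑_K e_K a_K ↦ ∑_K i^{|K|} e(a_K)`, for complex coordinates `e` on `A`. -/
noncomputable def sliceMap (n : ℕ) (e : A →L[ℝ] (Fin d → ℂ)) : StemSpace A n →L[ℝ] (Fin d → ℂ) :=
  ∑ K : Finset (Fin n), (Complex.I ^ K.card) • (e ∘L ContinuousLinearMap.proj K)

theorem sliceMap_apply (e : A →L[ℝ] (Fin d → ℂ)) (b : StemSpace A n) :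
    sliceMap n e b = ∑ K : Finset (Fin n), (Complex.I ^ K.card) • e (b K) := by
  simp [sliceMap]

/-- On a complex slice, every complex structure `𝒥_h` becomes the multiplication by `i`. -/
theorem sliceMap_cplxStr (e : A →L[ℝ] (Fin d → ℂ)) (h : Fin n) (b : StemSpace A n) :
    sliceMap n e (cplxStr h b) = Complex.I • sliceMap n e b := by
  have hsplit : ∀ g : Finset (Fin n) → (Fin d → ℂ), ∑ K : Finset (Fin n), g K =
      ∑ K ∈ (Finset.univ.erase h).powerset, (g K + g (insert h K)) := fun g => by
    rw [Finset.sum_add_distrib, ← Finset.sum_powerset_insert (Finset.notMem_erase h _),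
      Finset.insert_erase (Finset.mem_univ h), Finset.powerset_univ]
  rw [sliceMap_apply, sliceMap_apply, hsplit, hsplit, Finset.smul_sum]
  refine Finset.sum_congr rfl fun K hK => ?_
  have hh : h ∉ K := fun hh => Finset.notMem_erase h _ (Finset.mem_powerset.1 hK hh)
  simp only [cplxStr, hh, if_false, Finset.mem_insert_self, if_true, Finset.erase_insert hh,
    Finset.card_insert_of_notMem hh, map_neg, smul_add, smul_smul, pow_succ', smul_neg]
  rw [← mul_assoc, Complex.I_mul_I, neg_one_mul, neg_smul, add_comm]

/-- A holomorphic stem function becomes an ordinary holomorphic function of several variables on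
a complex slice. -/
theorem contDiffOn_complex_sliceMap (e : A →L[ℝ] (Fin d → ℂ)) {U : Set (Fin n → ℂ)}
    (hU : IsOpen U) {F : (Fin n → ℂ) → StemSpace A n} (hF : ContDiffOn ℝ 1 F U)
    (hbar : ∀ h, ∀ z ∈ U, stemDbar h F z = 0) :
    ContDiffOn ℂ 1 (fun z => sliceMap n e (F z)) U := by
  have hIm : ∀ h, ∀ z ∈ U, sliceMap n e (partialIm h F z) =
      Complex.I • sliceMap n e (partialRe h F z) := by
    intro h z hz
    have h1 : partialRe h F z + cplxStr h (partialIm h F z) = 0 :=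
      (smul_eq_zero.1 (hbar h z hz)).resolve_left (by norm_num)
    have h2 := congrArg (sliceMap n e) h1
    rw [map_add, map_zero, sliceMap_cplxStr] at h2
    rw [eq_neg_of_add_eq_zero_left h2, smul_neg, smul_smul, Complex.I_mul_I, neg_one_smul, neg_neg]
  refine contDiffOn_one_of_hasFDerivAt hU (f' := fun z => ∑ h,
    (ContinuousLinearMap.proj (R := ℂ) (φ := fun _ : Fin n => ℂ) h).smulRight
      (sliceMap n e (partialRe h F z))) ?_ fun z hz => ?_
  · refine continuousOn_finsetSum _ fun h _ => ?_
    have h1 : ContinuousOn (partialRe h F) U :=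
      (hF.continuousOn_fderiv_of_isOpen hU le_rfl).clm_apply continuousOn_const
    exact (ContinuousLinearMap.smulRightL ℂ (Fin n → ℂ) (Fin d → ℂ)
      (ContinuousLinearMap.proj h)).continuous.comp_continuousOn
        ((sliceMap n e).continuous.comp_continuousOn h1)
  · have hd : HasFDerivAt F (fderiv ℝ F z) z :=
      ((hF.differentiableOn one_ne_zero).differentiableAt (hU.mem_nhds hz)).hasFDerivAt
    refine hasFDerivAt_of_restrictScalars ℝ ((sliceMap n e).hasFDerivAt.comp z hd) ?_
    refine ContinuousLinearMap.ext fun v => ?_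
    have hv : v = ∑ h, ((v h).re • (Pi.single h 1 : Fin n → ℂ) +
        (v h).im • (Pi.single h Complex.I : Fin n → ℂ)) := by
      conv_lhs => rw [← Finset.univ_sum_single v]
      refine Finset.sum_congr rfl fun h _ => ?_
      rw [← Pi.single_smul, ← Pi.single_smul, ← Pi.single_add]
      congr 1
      simp [Complex.re_add_im]
    have hr : sliceMap n e (fderiv ℝ F z v) = ∑ h, ((v h).re • sliceMap n e (partialRe h F z) +
        (v h).im • sliceMap n e (partialIm h F z)) := by
      conv_lhs => rw [hv]
      simp only [map_sum, map_add, map_smul, partialRe, partialIm]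
    rw [ContinuousLinearMap.comp_apply, hr]
    simp only [ContinuousLinearMap.coe_restrictScalars', _root_.sum_apply,
      ContinuousLinearMap.smulRight_apply, ContinuousLinearMap.proj_apply]
    refine Finset.sum_congr rfl fun h _ => ?_
    rw [hIm h z hz]
    conv_lhs => rw [← Complex.re_add_im (v h)]
    rw [add_smul, mul_smul, Complex.coe_smul, Complex.coe_smul]

end Holomorphic

/-! ### Sums of power series and slice regular functions -/

section SumsOfSeries

open Metric

variable {A : Type*} [NonAssocRingWithNorm A] [NormedSpace ℝ A] [FiniteDimensional ℝ A]
  [SMulCommClass ℝ A A] [IsScalarTower ℝ A A] [StarRing A] {n : ℕ} {ρ : ℝ}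

theorem AbsConvergesOn.hasSum_monomial {a : (Fin n → ℕ) → A} (ha : AbsConvergesOn ρ a)
    {z : Fin n → ℂ} (hz : z ∈ ball (0 : Fin n → ℂ) ρ) {J : Fin n → A}
    (hJ : ∀ h, J h ∈ imagUnits A) :
    HasSum (fun ℓ => monomial (slicePoint J z) ℓ (a ℓ))
      (∑ K : Finset (Fin n), orderedProd J K (seriesStem a z K)) := by
  have : CompleteSpace A := FiniteDimensional.complete ℝ A
  simp only [monomial_slicePoint hJ]
  exact hasSum_sum fun K _ =>
    (LinearMap.toContinuousLinearMap (orderedProdLin J K)).hasSum (ha.hasSum_seriesStem hz K)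

omit [SMulCommClass ℝ A A] [IsScalarTower ℝ A A] [StarRing A] in
theorem absConvergesOn_of_summable {a : (Fin n → ℕ) → A}
    (h : ∀ r : ℝ, 0 < r → r < ρ → Summable fun ℓ => r ^ (∑ h, ℓ h) • a ℓ) :
    AbsConvergesOn ρ a := by
  intro r hr hrρ
  refine (h r hr hrρ).norm.congr fun ℓ => ?_
  rw [norm_smul, Real.norm_of_nonneg (by positivity)]

omit [NormedSpace ℝ A] [FiniteDimensional ℝ A] [SMulCommClass ℝ A A] [IsScalarTower ℝ A A]
  [StarRing A] in
theorem AbsConvergesOn.isConvergentSeries (hρ : 0 < ρ) {a : (Fin n → ℕ) → A}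
    (ha : AbsConvergesOn ρ a) : IsConvergentSeries a := by
  have hr : 0 < ρ / 2 := half_pos hρ
  have hs := ha _ hr (half_lt_self hρ)
  refine ⟨∑' ℓ, (ρ / 2) ^ (∑ h, ℓ h) * ‖a ℓ‖, (ρ / 2)⁻¹, inv_pos.2 hr, fun ℓ => ?_⟩
  rw [inv_pow, ← div_eq_mul_inv, le_div_iff₀ (by positivity), mul_comm]
  exact hs.le_tsum ℓ fun _ _ => by positivity

variable [IsAlternative A]

/-- At the real points the ordered monomials are the usual ones. -/
theorem monomial_real {J : A} (hJ : J ∈ imagUnits A) (r : ℝ) (ℓ : Fin n → ℕ) (v : A) :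
    monomial (slicePoint (fun _ => J) fun _ : Fin n => (r : ℂ)) ℓ v = r ^ (∑ h, ℓ h) • v := by
  obtain ⟨d, e, he⟩ := exists_complex_coordinates hJ
  apply e.injective
  rw [map_monomial_const hJ he, map_smul, Finset.prod_pow_eq_pow_sum, ← Complex.ofReal_pow,
    Complex.coe_smul]

variable [StarModule ℝ A] [Nontrivial A]

theorem const_mem_ball {r : ℝ} (hr : 0 < r) (hrρ : r < ρ) :
    (fun _ : Fin n => (r : ℂ)) ∈ ball (0 : Fin n → ℂ) ρ := by
  rw [mem_ball_zero_iff, pi_norm_lt_iff (hr.trans hrρ)]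
  intro _
  rwa [Complex.norm_real, Real.norm_of_nonneg hr.le]

/-- A power series converging to `f` on the product of balls converges absolutely, and `f` is
induced by its stem function. -/
theorem isSumOn_prodBall_iff (hS : (imagUnits A).Nonempty)
    (hnorm : ∀ x ∈ quadCone A, x * star x = (‖x‖ ^ 2) • (1 : A)) (hρ : 0 < ρ)
    {f : (Fin n → A) → A} {a : (Fin n → ℕ) → A} :
    IsSumOn f a (prodBall A n ρ) ↔
      AbsConvergesOn ρ a ∧ IsInducedBy (ball (0 : Fin n → ℂ) ρ) f (seriesStem a) := by
  constructor
  · rintro ⟨-, hsum⟩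
    obtain ⟨J, hJ⟩ := hS
    -- The real points `(r, …, r)` lie in the product of balls, and in finite dimension summability
    -- is absolute.
    have ha : AbsConvergesOn ρ a := absConvergesOn_of_summable fun r hr hrρ => by
      have h1 := hsum _ ((slicePoint_mem_prodBall hnorm hρ fun _ => hJ).2
        (const_mem_ball (n := n) hr hrρ))
      simpa only [monomial_real hJ] using h1.summable
    exact ⟨ha, fun z hz J hJ => (hsum _ ((slicePoint_mem_prodBall hnorm hρ hJ).2 hz)).unique
      (ha.hasSum_monomial hz hJ)⟩
  · rintro ⟨ha, hf⟩
    refine ⟨ha.isConvergentSeries hρ, fun x hx => ?_⟩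
    rw [(isCircularOf_prodBall hnorm hρ).2.2.2] at hx
    obtain ⟨z, hz, J, hJ, rfl⟩ := hx
    rw [hf z hz J hJ]
    exact ha.hasSum_monomial hz hJ

/-- The sum of a power series is slice regular. -/
theorem IsSumOn.sliceRegularOn (hS : (imagUnits A).Nonempty)
    (hnorm : ∀ x ∈ quadCone A, x * star x = (‖x‖ ^ 2) • (1 : A)) (hρ : 0 < ρ)
    {f : (Fin n → A) → A} {a : (Fin n → ℕ) → A} (hf : IsSumOn f a (prodBall A n ρ)) :
    SliceRegularOn f (prodBall A n ρ) := by
  have : CompleteSpace A := FiniteDimensional.complete ℝ A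
  obtain ⟨ha, hind⟩ := (isSumOn_prodBall_iff hS hnorm hρ).1 hf
  exact ⟨ball 0 ρ, isCircularOf_prodBall hnorm hρ, seriesStem a, isStem_seriesStem _ a,
    ha.contDiffOn_seriesStem, fun h z hz => ha.stemDbar_seriesStem hz h, hind⟩

/-- A slice regular function is the sum of a power series: the Taylor series of its restriction
to the slice `ℂ_Jⁿ` has coefficients in `A`, and the stem function of this series agrees with
that of `f` because a stem function is determined on a single slice. -/
theorem SliceRegularOn.exists_isSumOn (hS : (imagUnits A).Nonempty)
    (hnorm : ∀ x ∈ quadCone A, x * star x = (‖x‖ ^ 2) • (1 : A)) (hρ : 0 < ρ)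
    {f : (Fin n → A) → A} (hf : SliceRegularOn f (prodBall A n ρ)) :
    ∃ a : (Fin n → ℕ) → A, IsSumOn f a (prodBall A n ρ) := by
  obtain ⟨D, hD, F, hstem, hC1, hbar, hind⟩ := hf
  obtain rfl := hD.eq_ball hS hnorm hρ
  obtain ⟨J, hJ⟩ := id hS
  obtain ⟨d, e, he⟩ := exists_complex_coordinates hJ
  have hslice : ∀ b : StemSpace A n,
      sliceMap n (LinearMap.toContinuousLinearMap e.toLinearMap) b =
        e (∑ K : Finset (Fin n), orderedProd (fun _ => J) K (b K)) := fun b => by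
    rw [sliceMap_apply, map_sum]
    exact Finset.sum_congr rfl fun K _ => (map_orderedProd_const he K _).symm
  obtain ⟨c, -, hc⟩ := exists_hasSum_of_contDiffOn_ball hρ
    (contDiffOn_complex_sliceMap (LinearMap.toContinuousLinearMap e.toLinearMap) isOpen_ball
      hC1 hbar)
  have hsum : ∀ z ∈ ball (0 : Fin n → ℂ) ρ,
      HasSum (fun ℓ => monomial (slicePoint (fun _ => J) z) ℓ (e.symm (c ℓ)))
        (∑ K : Finset (Fin n), orderedProd (fun _ => J) K (F z K)) := fun z hz => by
    have h1 := (LinearMap.toContinuousLinearMap e.symm.toLinearMap).hasSum (hc z hz)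
    rw [hslice] at h1
    simp only [LinearMap.coe_toContinuousLinearMap', LinearEquiv.coe_coe,
      LinearEquiv.symm_apply_apply] at h1
    refine h1.congr_fun fun ℓ => ?_
    apply e.injective
    rw [map_monomial_const hJ he]
    simp
  have ha : AbsConvergesOn ρ fun ℓ => e.symm (c ℓ) :=
    absConvergesOn_of_summable fun r hr hrρ => by
      simpa only [monomial_real hJ] using (hsum _ (const_mem_ball hr hrρ)).summable
  have heq : Set.EqOn F (seriesStem fun ℓ => e.symm (c ℓ)) (ball 0 ρ) :=
    hstem.eq_of_const_slice (conjInvariant_ball hρ) (isStem_seriesStem _ _) hJ fun z hz =>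
      (hsum z hz).unique (ha.hasSum_monomial hz fun _ => hJ)
  refine ⟨_, (isSumOn_prodBall_iff hS hnorm hρ).2 ⟨ha, fun z hz J' hJ' => ?_⟩⟩
  rw [hind z hz J' hJ', heq hz]

/-- The slice partial derivatives of the sum of a power series are computed term by term. -/
theorem IsSumOn.of_hasSlicePartial (hS : (imagUnits A).Nonempty)
    (hnorm : ∀ x ∈ quadCone A, x * star x = (‖x‖ ^ 2) • (1 : A)) (hρ : 0 < ρ)
    {f g : (Fin n → A) → A} {a : (Fin n → ℕ) → A} (hf : IsSumOn f a (prodBall A n ρ))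
    {h : Fin n} (hg : HasSlicePartial (prodBall A n ρ) h f g) :
    IsSumOn g (formalDeriv h a) (prodBall A n ρ) := by
  have : CompleteSpace A := FiniteDimensional.complete ℝ A
  obtain ⟨ha, hfa⟩ := (isSumOn_prodBall_iff hS hnorm hρ).1 hf
  obtain ⟨D, hD, F, hstem, -, hfF, hgF⟩ := hg
  obtain rfl := hD.eq_ball hS hnorm hρ
  obtain ⟨J, hJ⟩ := id hS
  have heq : Set.EqOn F (seriesStem a) (ball 0 ρ) :=
    hstem.eq_of_const_slice (conjInvariant_ball hρ) (isStem_seriesStem _ _) hJ fun z hz =>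
      (hfF z hz _ fun _ => hJ).symm.trans (hfa z hz _ fun _ => hJ)
  refine (isSumOn_prodBall_iff hS hnorm hρ).2 ⟨ha.formalDeriv h, fun z hz J' hJ' => ?_⟩
  have hfd : fderiv ℝ F z = fderiv ℝ (seriesStem a) z :=
    Filter.EventuallyEq.fderiv_eq (heq.eventuallyEq_of_mem (isOpen_ball.mem_nhds hz))
  rw [hgF z hz J' hJ', ← ha.stemD_seriesStem hz h]
  simp only [stemD, partialRe, partialIm, hfd]

theorem IsSumOn.exists_hasSlicePartial (hS : (imagUnits A).Nonempty)
    (hnorm : ∀ x ∈ quadCone A, x * star x = (‖x‖ ^ 2) • (1 : A)) (hρ : 0 < ρ)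
    {f : (Fin n → A) → A} {a : (Fin n → ℕ) → A} (hf : IsSumOn f a (prodBall A n ρ))
    (h : Fin n) : ∃ g, HasSlicePartial (prodBall A n ρ) h f g := by
  have : CompleteSpace A := FiniteDimensional.complete ℝ A
  obtain ⟨ha, hfa⟩ := (isSumOn_prodBall_iff hS hnorm hρ).1 hf
  refine ⟨fun x => ∑' ℓ, monomial x ℓ (formalDeriv h a ℓ), ball 0 ρ,
    isCircularOf_prodBall hnorm hρ, seriesStem a, isStem_seriesStem _ a,
    ha.contDiffOn_seriesStem, hfa, fun z hz J hJ => ?_⟩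
  rw [ha.stemD_seriesStem hz h]
  exact ((ha.formalDeriv h).hasSum_monomial hz hJ).tsum_eq

theorem IsSumOn.exists_hasIterSlicePartial (hS : (imagUnits A).Nonempty)
    (hnorm : ∀ x ∈ quadCone A, x * star x = (‖x‖ ^ 2) • (1 : A)) (hρ : 0 < ρ) (w : List (Fin n))
    {f : (Fin n → A) → A} {a : (Fin n → ℕ) → A} (hf : IsSumOn f a (prodBall A n ρ)) :
    ∃ g, HasIterSlicePartial (prodBall A n ρ) w f g := by
  induction w generalizing f a with
  | nil => exact ⟨f, Set.eqOn_refl f _⟩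
  | cons h w ih =>
    obtain ⟨f₁, hf₁⟩ := hf.exists_hasSlicePartial hS hnorm hρ h
    obtain ⟨g, hg⟩ := ih (hf.of_hasSlicePartial hS hnorm hρ hf₁)
    exact ⟨g, f₁, hf₁, hg⟩

theorem IsSumOn.apply_zero (hS : (imagUnits A).Nonempty)
    (hnorm : ∀ x ∈ quadCone A, x * star x = (‖x‖ ^ 2) • (1 : A)) (hρ : 0 < ρ)
    {f : (Fin n → A) → A} {a : (Fin n → ℕ) → A} (hf : IsSumOn f a (prodBall A n ρ)) :
    f 0 = a 0 := by
  obtain ⟨J, hJ⟩ := hS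
  have h0 : slicePoint (fun _ => J) (fun _ : Fin n => ((0 : ℝ) : ℂ)) = 0 :=
    funext fun h => by simp [slicePoint]
  have hmem : (fun _ : Fin n => ((0 : ℝ) : ℂ)) ∈ ball (0 : Fin n → ℂ) ρ := by
    rw [mem_ball_zero_iff, pi_norm_lt_iff hρ]
    simpa using fun _ => hρ
  have h1 := hf.2 _ ((slicePoint_mem_prodBall hnorm hρ fun _ => hJ).2 hmem)
  simp only [monomial_real hJ] at h1
  rw [h0] at h1
  refine h1.unique ?_
  convert hasSum_single (0 : Fin n → ℕ) (f := fun ℓ => (0 : ℝ) ^ (∑ h, ℓ h) • a ℓ) ?_ using 1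
  · simp
  · intro ℓ hℓ
    obtain ⟨h, hh⟩ := Function.ne_iff.1 hℓ
    have : ∑ h, ℓ h ≠ 0 := fun hs =>
      hh (Finset.sum_eq_zero_iff.1 hs h (Finset.mem_univ h))
    simp [zero_pow this]

/-- The values at the origin of the iterated slice partial derivatives of the sum of a power
series are its coefficients, up to factorials. -/
theorem IsSumOn.apply_zero_of_hasIterSlicePartial (hS : (imagUnits A).Nonempty)
    (hnorm : ∀ x ∈ quadCone A, x * star x = (‖x‖ ^ 2) • (1 : A)) (hρ : 0 < ρ) (w : List (Fin n))
    {f g : (Fin n → A) → A} {a : (Fin n → ℕ) → A} (hf : IsSumOn f a (prodBall A n ρ))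
    (hg : HasIterSlicePartial (prodBall A n ρ) w f g) :
    g 0 = ((∏ h, (w.count h).factorial : ℕ) : ℝ) • a fun h => w.count h := by
  induction w generalizing f a with
  | nil =>
    obtain ⟨J, hJ⟩ := id hS
    have h0 : (0 : Fin n → A) ∈ prodBall A n ρ := fun h =>
      ⟨⟨J, hJ, 0, 0, by simp⟩, by simpa using hρ⟩
    rw [hg h0, hf.apply_zero hS hnorm hρ]
    simp [Pi.zero_def]
  | cons j w ih =>
    obtain ⟨f₁, hf₁, hg₁⟩ := hg
    have hcount : (fun h => (j :: w).count h) = (fun h => w.count h) + Pi.single j 1 := by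
      funext h
      rcases eq_or_ne h j with rfl | hne
      · simp
      · simp [hne, List.count_cons_of_ne hne.symm]
    have hfact : (∏ h, ((j :: w).count h).factorial) =
        (∏ h, (w.count h).factorial) * (w.count j + 1) := by
      rw [← Finset.mul_prod_erase _ _ (Finset.mem_univ j),
        ← Finset.mul_prod_erase Finset.univ (fun h => (w.count h).factorial) (Finset.mem_univ j),
        List.count_cons_self, Nat.factorial_succ,
        Finset.prod_congr rfl fun h hh => by
          rw [List.count_cons_of_ne (Finset.ne_of_mem_erase hh).symm]]
      ring
    rw [ih (hf.of_hasSlicePartial hS hnorm hρ hf₁) hg₁, hcount, hfact, formalDeriv, smul_smul]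
    push_cast
    rfl

end SumsOfSeries

end SliceReg

theorem mainTheorem4 {A : Type*} [SliceReg.NonAssocRingWithNorm A] [Nontrivial A]
    [NormedSpace ℝ A] [FiniteDimensional ℝ A] [SMulCommClass ℝ A A] [IsScalarTower ℝ A A]
    [SliceReg.IsAlternative A] [StarRing A] [StarModule ℝ A]
    (hS : (SliceReg.imagUnits A).Nonempty)
    (hnorm : ∀ x ∈ SliceReg.quadCone A, x * star x = (‖x‖ ^ 2) • (1 : A))
    (n : ℕ) (hn : 0 < n) (ρ : ℝ) (hρ : 0 < ρ) (f : (Fin n → A) → A) :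
    (SliceReg.SliceRegularOn f (SliceReg.prodBall A n ρ) ↔
      ∃ a : (Fin n → ℕ) → A, SliceReg.IsSumOn f a (SliceReg.prodBall A n ρ)) ∧
    (SliceReg.SliceRegularOn f (SliceReg.prodBall A n ρ) →
      ∀ a : (Fin n → ℕ) → A, SliceReg.IsSumOn f a (SliceReg.prodBall A n ρ) →
        ∀ (ℓ : Fin n → ℕ) (w : List (Fin n)), (∀ h, w.count h = ℓ h) →
          (∃ g, SliceReg.HasIterSlicePartial (SliceReg.prodBall A n ρ) w f g) ∧
          ∀ g, SliceReg.HasIterSlicePartial (SliceReg.prodBall A n ρ) w f g →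
            a ℓ = ((∏ h, (ℓ h).factorial : ℕ) : ℝ)⁻¹ • g 0) := by

  refine ⟨⟨fun hf => hf.exists_isSumOn hS hnorm hρ, fun ⟨a, ha⟩ =>
    ha.sliceRegularOn hS hnorm hρ⟩, fun _ a ha ℓ w hw => ?_⟩
  refine ⟨ha.exists_hasIterSlicePartial hS hnorm hρ w, fun g hg => ?_⟩
  have h1 := ha.apply_zero_of_hasIterSlicePartial hS hnorm hρ w hg
  simp only [hw] at h1
  rw [h1, inv_smul_smul₀]
  exact_mod_cast Finset.prod_ne_zero_iff.2 fun h _ => (ℓ h).factorial_ne_zero
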